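/- Let $d\ge 1$ and $L\ge 0$ be integers and $N=\binom{d+L}{d}$. Let $g:(0,\infty)\to(0,\infty)$ be an increasing (i.e. strictly increasing) $C^1$ function with $\lim_{t\to 0}g(t)=0$, $\lim_{t\to\infty}g(t)=\infty$, and $g'(t)\neq 0$ for Lebesgue-almost every $t>0$. Let $\mathcal H\subset L^2(\mathbb C^d)$ (Lebesgue measure) be the span of the functions $$\frac{z_1^{\alpha_1}\cdots z_d^{\alpha_d}}{(1+\|z\|^2)^{(d+L+1)/2}},\qquad \alpha_1+\dots+\alpha_d\le L .$$ Identify $\mathbb C^d$ with $\mathbb R^{2d}$ by $z\equiv(\mathrm{Re}\,z_1,\mathrm{Im}\,z_1,\dots,\mathrm{Re}\,z_d,\mathrm{Im}\,z_d)$, let $\Pi:\mathbb S^{2d}\to\mathbb C^d$, $\Pi(p)=(p_1,\dots,p_{2d})/(1-p_{2d+1})$, be the stereographic projection, and let $\varphi_g(x)=g(\|x\|)\,x/\|x\|$ for $x\neq0$ (and $\varphi_g(0)=0$), a bijection of $\mathbb C^d$. A determinantal point process (DPP) with kernel $K$ on a space with reference measure $\mu$ is a simple point process with joint intensities $\rho_k(x_1,\dots,x_k)=\det(K(x_i,x_j))_{i,j\le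 k}$ with respect to $\mu$ for all $k$. The projection DPP of $\mathcal H$ is the DPP on $\mathbb C^d$ whose kernel is the reproducing kernel of $\mathcal H$. Then there exists a projection DPP of $\mathcal H$ having almost surely $N$ points, and for every projection DPP $\mathfrak X_{\mathcal H}$ of $\mathcal H$ the push-forward of $\mathfrak X_{\mathcal H}$ under the (measurable) map $\Pi^{-1}\circ\varphi_g:\mathbb C^d\to\mathbb S^{2d}$ is a DPP on $\mathbb S^{2d}$, with respect to the surface measure, with kernel $$K_*(p,q)=\frac{N\,d!\,(1+\langle z,w\rangle)^L\,R(\|z\|)\,R(\|w\|)}{\pi^d\,2^{2d}},\qquad z=\varphi_g^{-1}(\Pi(p)),\quad w=\varphi_g^{-1}(\Pi(q)),$$ where $\langle z,w\rangle=\sum_i z_i\overline{w_i}$ and $$R(t)=\frac{(g(t)^2+1)^d\,t^{d-\frac12}}{\sqrt{g'(t)}\;g(t)^{d-\frac12}\,(1+t^2)^{\frac{d+L+1}{2}}}\qquad(t>0,\ g'(t)\neq0).$$ The kernel is understood for almost every $p,q$; we set $R(t)=0$ if $t=0$ or $g'(t)=0$, and the value at the north pole is irrelevant. -/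

import Mathlib

open MeasureTheory Set Filter Topology
open scoped ENNReal NNReal ComplexConjugate

universe u

noncomputable section

/-! ### Point processes and determinantal point processes -/

/-- `m` is the counting measure of a locally finite set `S` of points: a simple, locally finite,
integer-valued measure. -/
def IsSimpleCountingMeasure {Λ : Type*} [TopologicalSpace Λ] [MeasurableSpace Λ]
    (m : Measure Λ) : Prop :=
  ∃ S : Set Λ, (∀ C : Set Λ, IsCompact C → (S ∩ C).Finite) ∧
    ∀ A : Set Λ, MeasurableSet A → m A = ((S ∩ A).encard : ℝ≥0∞)

/-- A simple point process on `Λ`, defined on `(Ω, P)`: a random measure which is almost surely the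
counting measure of a locally finite set of points. -/
structure IsSimplePointProcess {Ω Λ : Type*} [MeasurableSpace Ω] [TopologicalSpace Λ]
    [MeasurableSpace Λ] (P : Measure Ω) (X : Ω → Measure Λ) : Prop where
  measurable : Measurable X
  simple : ∀ᵐ ω ∂P, IsSimpleCountingMeasure (X ω)

/-- The functions `ρ k : Λ ^ k → [0, ∞)` are the joint intensities of the point process `X` with
respect to `μ`: for pairwise disjoint measurable `D 1, …, D k`,
`E [X (D 1) ⋯ X (D k)]` is the integral of `ρ k` over `D 1 × ⋯ × D k`, and `ρ k` vanishes at points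
with two equal coordinates. -/
structure HasJointIntensities {Ω Λ : Type*} [MeasurableSpace Ω] [MeasurableSpace Λ]
    (P : Measure Ω) (X : Ω → Measure Λ) (μ : Measure Λ) [SigmaFinite μ]
    (ρ : (k : ℕ) → (Fin k → Λ) → ℝ≥0) : Prop where
  measurable : ∀ k, Measurable (ρ k)
  lintegral_prod : ∀ (k : ℕ) (D : Fin k → Set Λ), (∀ i, MeasurableSet (D i)) →
    Pairwise (fun i j => Disjoint (D i) (D j)) →
    ∫⁻ ω, ∏ i, X ω (D i) ∂P
      = ∫⁻ x in Set.pi univ D, (ρ k x : ℝ≥0∞) ∂(Measure.pi fun _ : Fin k => μ)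
  diag : ∀ (k : ℕ) (x : Fin k → Λ), ¬ Function.Injective x → ρ k x = 0

/-- `X` is a determinantal point process with kernel `K` with respect to the measure `μ`: it is
simple and its joint intensities are `ρ k (x 1, …, x k) = det (K (x i) (x j))`. -/
structure IsDPP {Ω Λ : Type*} [MeasurableSpace Ω] [TopologicalSpace Λ] [MeasurableSpace Λ]
    (P : Measure Ω) (X : Ω → Measure Λ) (μ : Measure Λ) [SigmaFinite μ]
    (K : Λ → Λ → ℂ) : Prop where
  simple : IsSimplePointProcess P X
  det : ∃ ρ : (k : ℕ) → (Fin k → Λ) → ℝ≥0, HasJointIntensities P X μ ρ ∧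
    ∀ (k : ℕ) (x : Fin k → Λ),
      (Matrix.of fun i j => K (x i) (x j)).det = (((ρ k x : ℝ≥0) : ℝ) : ℂ)

/-- `K` is the reproducing kernel of the space `H` of square-integrable functions. -/
structure IsReproducingKernel {Λ : Type*} [MeasurableSpace Λ] (μ : Measure Λ)
    (H : Submodule ℂ (Λ → ℂ)) (K : Λ → Λ → ℂ) : Prop where
  memLp : ∀ f ∈ H, MemLp f 2 μ
  mem : ∀ w, (fun z => K z w) ∈ H
  reproducing : ∀ f ∈ H, ∀ w, f w = ∫ z, f z * conj (K z w) ∂μ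

/-- `X` is a projection determinantal point process of the space `H`: it is determinantal with the
reproducing kernel of `H` as its kernel. -/
def IsProjectionDPP {Ω Λ : Type*} [MeasurableSpace Ω] [TopologicalSpace Λ] [MeasurableSpace Λ]
    (P : Measure Ω) (X : Ω → Measure Λ) (μ : Measure Λ) [SigmaFinite μ]
    (H : Submodule ℂ (Λ → ℂ)) : Prop :=
  ∃ K : Λ → Λ → ℂ, IsReproducingKernel μ H K ∧ IsDPP P X μ K

/-! ### Spaces -/

/-- `ℂ^d` with its Hermitian norm. -/
abbrev Cd (d : ℕ) : Type := EuclideanSpace ℂ (Fin d)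

/-- The unit sphere `S^{2d}` of `ℝ^{2d+1}`. -/
abbrev Sph (d : ℕ) : Type := Metric.sphere (0 : EuclideanSpace ℝ (Fin (2 * d + 1))) 1

/-- The surface measure of `S^{2d}`. -/
def surfaceMeasure (d : ℕ) : Measure (Sph d) :=
  (volume : Measure (EuclideanSpace ℝ (Fin (2 * d + 1)))).toSphere

instance (d : ℕ) : IsFiniteMeasure (surfaceMeasure d) := by
  unfold surfaceMeasure
  infer_instance

/-! ### Stereographic projection, with `z` in `ℂ^d` identified with
`(Re z_1, Im z_1, …, Re z_d, Im z_d)` in `ℝ^{2d}` -/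

/-- The identification of `ℂ^d` with `ℝ^{2d}`, in coordinates. -/
def realCoord {d : ℕ} (z : Cd d) (i : Fin (2 * d)) : ℝ :=
  if (i : ℕ) % 2 = 0 then (z ⟨(i : ℕ) / 2, by omega⟩).re else (z ⟨(i : ℕ) / 2, by omega⟩).im

/-- The stereographic projection `p ↦ (p_1, …, p_{2d}) / (1 - p_{2d+1})` from the north pole.
(At the north pole itself the value is the junk value `0`; this is a single point.) -/
def stereo {d : ℕ} (p : Sph d) : Cd d :=
  WithLp.toLp 2 fun j : Fin d =>
    (⟨p.1 ⟨2 * (j : ℕ), by omega⟩ / (1 - p.1 (Fin.last (2 * d))),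
      p.1 ⟨2 * (j : ℕ) + 1, by omega⟩ / (1 - p.1 (Fin.last (2 * d)))⟩ : ℂ)

/-- The vector `(2 y_1, …, 2 y_{2d}, ‖y‖² - 1) / (‖y‖² + 1)` of `ℝ^{2d+1}`. -/
def stereoInvVec {d : ℕ} (z : Cd d) : EuclideanSpace ℝ (Fin (2 * d + 1)) :=
  WithLp.toLp 2 (Fin.snoc (α := fun _ => ℝ)
    (fun i : Fin (2 * d) => 2 * realCoord z i / (‖z‖ ^ 2 + 1))
    ((‖z‖ ^ 2 - 1) / (‖z‖ ^ 2 + 1)))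

theorem sum_realCoord_sq {d : ℕ} (z : Cd d) : ∑ i, realCoord z i ^ 2 = ‖z‖ ^ 2 := by
  rw [EuclideanSpace.norm_sq_eq,
    ← (finProdFinEquiv.trans (finCongr (Nat.mul_comm d 2))).sum_comp, Fintype.sum_prod_type]
  refine Finset.sum_congr rfl fun j _ => ?_
  rw [Fin.sum_univ_two, Complex.sq_norm, Complex.normSq_apply]
  have h1 : (1 + 2 * (j : ℕ)) / 2 = j := by omega
  have h2 : (2 * (j : ℕ)) / 2 = j := by omega
  have h3 : (1 + 2 * (j : ℕ)) % 2 = 1 := by omega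
  simp [realCoord, h1, h3, sq]

theorem stereoInvVec_mem {d : ℕ} (z : Cd d) :
    stereoInvVec z ∈ Metric.sphere (0 : EuclideanSpace ℝ (Fin (2 * d + 1))) 1 := by
  have hpos : (0 : ℝ) < ‖z‖ ^ 2 + 1 := by positivity
  have h : ‖stereoInvVec z‖ ^ 2 = 1 := by
    rw [EuclideanSpace.norm_sq_eq, Fin.sum_univ_castSucc]
    simp only [stereoInvVec, Fin.snoc_castSucc, Fin.snoc_last, Real.norm_eq_abs, sq_abs, div_pow,
      mul_pow]
    rw [← Finset.sum_div, ← Finset.mul_sum, sum_realCoord_sq]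
    field_simp
    ring
  rw [mem_sphere_zero_iff_norm]
  exact (pow_eq_one_iff_of_nonneg (norm_nonneg _) two_ne_zero).1 h

/-- The inverse stereographic projection. -/
def stereoInv {d : ℕ} (z : Cd d) : Sph d := ⟨stereoInvVec z, stereoInvVec_mem z⟩

/-! ### The radial maps -/

/-- The admissible functions `g : (0, ∞) → (0, ∞)`: increasing, `C^1`, tending to `0` at `0` and
to `∞` at `∞`. (Values of `g` outside `(0, ∞)` play no role.) -/
structure IsAdmissible (g : ℝ → ℝ) : Prop where
  pos : ∀ t ∈ Ioi (0 : ℝ), 0 < g t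
  strictMonoOn : StrictMonoOn g (Ioi 0)
  contDiffOn : ContDiffOn ℝ 1 g (Ioi 0)
  tendsto_zero : Tendsto g (𝓝[>] 0) (𝓝 0)
  tendsto_atTop : Tendsto g atTop atTop

/-- `φ_g (x) = g (‖x‖) x / ‖x‖`, extended by `φ_g (0) = 0`. -/
def radialMap {d : ℕ} (g : ℝ → ℝ) (x : Cd d) : Cd d := (g ‖x‖ / ‖x‖) • x

/-- `φ_g⁻¹ (y) = g⁻¹ (‖y‖) y / ‖y‖`, extended by `φ_g⁻¹ (0) = 0`. -/
def radialMapInv {d : ℕ} (g : ℝ → ℝ) (y : Cd d) : Cd d :=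
  (Function.invFunOn g (Ioi 0) ‖y‖ / ‖y‖) • y

/-- The map `Π⁻¹ ∘ φ_g` from `ℂ^d` to `S^{2d}`. -/
def toSph {d : ℕ} (g : ℝ → ℝ) (x : Cd d) : Sph d := stereoInv (radialMap g x)

/-! ### The space of weighted polynomials and the kernel on the sphere -/

/-- `z_1^{α_1} ⋯ z_d^{α_d} / (1 + ‖z‖²)^{(d + L + 1) / 2}`. -/
def weightedMonomial (d L : ℕ) (α : Fin d → ℕ) (z : Cd d) : ℂ :=
  (∏ i, z i ^ α i) / (((1 + ‖z‖ ^ 2) ^ (((d : ℝ) + L + 1) / 2) : ℝ) : ℂ)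

/-- The span of the weighted monomials with `α_1 + ⋯ + α_d ≤ L`. (The positive constants which
normalize the monomials in `L²` do not change the span.) -/
def weightedPolynomials (d L : ℕ) : Submodule ℂ (Cd d → ℂ) :=
  Submodule.span ℂ {f | ∃ α : Fin d → ℕ, ∑ i, α i ≤ L ∧ f = weightedMonomial d L α}

/-- `R (t) = (g (t)² + 1)^d t^{d - 1/2} /
  (√(g' (t)) g (t)^{d - 1/2} (1 + t²)^{(d + L + 1) / 2})`. -/
def radialWeight (d L : ℕ) (g : ℝ → ℝ) (t : ℝ) : ℝ :=
  ((g t ^ 2 + 1) ^ d * t ^ ((d : ℝ) - 1 / 2)) /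
    (√(deriv g t) * g t ^ ((d : ℝ) - 1 / 2) * (1 + t ^ 2) ^ (((d : ℝ) + L + 1) / 2))

/-- The kernel `N d! (1 + ⟨z, w⟩)^L R (‖z‖) R (‖w‖) / (π^d 2^{2d})` with `N = (d + L).choose d`,
`z = φ_g⁻¹ (Π p)` and `w = φ_g⁻¹ (Π q)`. Here `⟨z, w⟩` is `∑ z_i conj (w_i)`, which is
`inner ℂ w z`, as Mathlib's inner product is linear in the second variable. -/
def sphereKernel (d L : ℕ) (g : ℝ → ℝ) (p q : Sph d) : ℂ :=
  let z : Cd d := radialMapInv g (stereo p)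
  let w : Cd d := radialMapInv g (stereo q)
  (((d + L).choose d : ℕ) : ℂ) * ((d.factorial : ℕ) : ℂ) * (1 + inner ℂ w z) ^ L *
      (radialWeight d L g ‖z‖ : ℂ) * (radialWeight d L g ‖w‖ : ℂ) /
    ((Real.pi : ℂ) ^ d * 2 ^ (2 * d))

end

noncomputable section

/-! Fix an orthonormal basis `ψ` of the space of weighted polynomials; its reproducing kernel is
K(x, y) = ∑ ψ_a(x) conj(ψ_a(y)).

Existence (`IsOrthonormalFamily.exists_isDPP`). The determinants det K(x_i, x_j) are Gram
determinants, hence nonnegative, and they are symmetric in the points. Expanding along a border and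
using the reproducing property, integrating out one of k + 1 points multiplies the determinant of
the remaining k by N - k (`IsOrthonormalFamily.integral_det_cons`). Thus det K / N! is a probability
density on N-tuples whose marginals are multiples of the lower determinants, and the sum of the
Dirac masses of the random tuple has these determinants as joint intensities.

Push-forward (`IsDPP.map`). Let T be injective with measurable left inverse S, and let the image of
μ under T have density s² with respect to μ'. The k-th intensity then becomes ∏ s(p_i)² times the
old one at the points S(p_i), and scaling rows and columns puts this factor into the kernel s(p)
s(q) K(S p, S q). What remains is to compute s and K.

For s, the inverse stereographic projection contributes (2 / (‖y‖² + 1))^{2d} (`map_stereoInv`), and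
polar coordinates give the density t^{2d-1} / (g'(t) g(t)^{2d-1}) of the image of Lebesgue measure
under the radial map at norm g(t) (`IsAdmissible.map_radialMap`). The image has no singular part
because g' ≠ 0 almost everywhere.

For K, rotating one coordinate shows that distinct monomials are orthogonal, a Gamma integral gives
their norms (`lintegral_monomial`), and the multinomial theorem sums the basis expansion
(`orthKernel_monomialFamily`). Reproducing kernels are unique pointwise, so the formula covers every
projection process. -/

/-- Expansion of a bordered determinant along its border. -/
theorem det_bordered {k : ℕ} (M : Matrix (Fin (k + 1)) (Fin (k + 1)) ℂ) :
    M.det = M 0 0 * (M.submatrix Fin.succ Fin.succ).det -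
      ∑ i, ∑ j, (M.submatrix Fin.succ Fin.succ).adjugate j i * (M i.succ 0 * M 0 j.succ) := by
  classical
  set A := M.submatrix Fin.succ Fin.succ with hA
  rw [Matrix.det_succ_row_zero, Fin.sum_univ_succ]
  simp only [Fin.val_zero, pow_zero, one_mul, Fin.succAbove_zero, ← hA]
  rw [sub_eq_add_neg]
  congr 1
  rw [Finset.sum_comm, ← Finset.sum_neg_distrib]
  refine Finset.sum_congr rfl fun j _ => ?_
  have h1 : ∑ i, A.adjugate j i * (M i.succ 0 * M 0 j.succ)
      = M 0 j.succ * (A.updateCol j fun i => M i.succ 0).det := by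
    rw [← Matrix.cramer_apply, Matrix.cramer_eq_adjugate_mulVec, Matrix.mulVec, dotProduct,
      Finset.mul_sum]
    exact Finset.sum_congr rfl fun i _ => by ring
  -- The minor keeps the border column in front. Moving it to position j is a cycle of sign (-1)^j,
  -- which cancels the Laplace sign (-1)^{j+1} up to -1.
  have h2 : (M.submatrix Fin.succ j.succ.succAbove)
      = (A.updateCol j fun i => M i.succ 0).submatrix id j.cycleRange.symm := by
    ext i c
    obtain ⟨c, rfl⟩ := j.cycleRange.surjective c
    rw [Matrix.submatrix_apply, Matrix.submatrix_apply, Fin.succAbove_cycleRange,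
      Equiv.symm_apply_apply, Matrix.updateCol_apply]
    split_ifs with hc
    · rw [hc, Equiv.swap_apply_right, id]
    · rw [Equiv.swap_apply_of_ne_of_ne (Fin.succ_ne_zero c) (by simpa using hc)]
      rfl
  rw [h1, h2, Matrix.det_permute', Equiv.Perm.sign_symm, Fin.sign_cycleRange]
  push_cast
  rw [Fin.val_succ, pow_succ]
  have : ((-1 : ℂ) ^ (j:ℕ)) * (-1) ^ (j : ℕ) = 1 := by
    rw [← mul_pow]; simp
  linear_combination (-(M 0 j.succ) * (A.updateCol j fun i => M i.succ 0).det) * this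

/-! ### Determinantal point processes of finite-dimensional projections -/

section ProjectionProcess

variable {Λ : Type*}

/-- The kernel of the projection onto the span of an orthonormal family. -/
def orthKernel {N : ℕ} (ψ : Fin N → Λ → ℂ) (x y : Λ) : ℂ := ∑ a, ψ a x * conj (ψ a y)

/-- The matrix of the values of a kernel at a tuple of points. -/
def kernelMatrix (K : Λ → Λ → ℂ) {k : ℕ} (x : Fin k → Λ) : Matrix (Fin k) (Fin k) ℂ :=
  Matrix.of fun i j => K (x i) (x j)

/-- The joint intensities of a determinantal point process with a positive semidefinite kernel. -/
def detIntensity (K : Λ → Λ → ℂ) (k : ℕ) (x : Fin k → Λ) : ℝ≥0 :=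
  (kernelMatrix K x).det.re.toNNReal

variable {N : ℕ} {ψ : Fin N → Λ → ℂ}

/-- This Gram factorization through ℂ^N gives both nonnegativity of the determinants and their
vanishing for more than N points. -/
theorem kernelMatrix_orthKernel {k : ℕ} (x : Fin k → Λ) :
    kernelMatrix (orthKernel ψ) x =
      (Matrix.of fun (i : Fin k) a => ψ a (x i)) *
        (Matrix.of fun (i : Fin k) a => ψ a (x i)).conjTranspose := by
  ext i j
  simp [kernelMatrix, orthKernel, Matrix.mul_apply]

theorem coe_detIntensity_orthKernel (k : ℕ) (x : Fin k → Λ) :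
    (((detIntensity (orthKernel ψ) k x : ℝ≥0) : ℝ) : ℂ) =
      (kernelMatrix (orthKernel ψ) x).det := by
  open scoped ComplexOrder in
  have h : 0 ≤ (kernelMatrix (orthKernel ψ) x).det := by
    rw [kernelMatrix_orthKernel]
    exact (Matrix.posSemidef_self_mul_conjTranspose _).det_nonneg
  rw [Complex.nonneg_iff] at h
  rw [detIntensity, Real.coe_toNNReal _ h.1]
  exact Complex.ext rfl h.2

theorem det_kernelMatrix_eq_zero_of_lt {k : ℕ} (hk : N < k) (x : Fin k → Λ) :
    (kernelMatrix (orthKernel ψ) x).det = 0 := by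
  by_contra h
  have h1 := Matrix.rank_of_isUnit _ ((Matrix.isUnit_iff_isUnit_det _).2 (isUnit_iff_ne_zero.2 h))
  rw [kernelMatrix_orthKernel] at h1
  have h2 := (Matrix.rank_mul_le_left (Matrix.of fun (i : Fin k) a => ψ a (x i))
    (Matrix.of fun (i : Fin k) a => ψ a (x i)).conjTranspose).trans (Matrix.rank_le_width _)
  rw [h1, Fintype.card_fin] at h2
  omega

theorem det_kernelMatrix_eq_zero_of_not_injective (K : Λ → Λ → ℂ) {k : ℕ} {x : Fin k → Λ}
    (hx : ¬ Function.Injective x) : (kernelMatrix K x).det = 0 := by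
  simp only [Function.Injective, not_forall] at hx
  obtain ⟨i, j, hij, hne⟩ := hx
  refine Matrix.det_zero_of_row_eq hne ?_
  ext l
  simp [kernelMatrix, hij]

theorem orthKernel_mul_orthKernel (x z y : Λ) :
    orthKernel ψ x y * orthKernel ψ y z =
      ∑ a, ∑ b, ψ a x * conj (ψ b z) * (ψ b y * conj (ψ a y)) := by
  rw [orthKernel, orthKernel, Finset.sum_mul_sum]
  exact Finset.sum_congr rfl fun a _ => Finset.sum_congr rfl fun b _ => by ring

theorem det_kernelMatrix_cons (K : Λ → Λ → ℂ) {k : ℕ} (x : Fin k → Λ) (y : Λ) :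
    (kernelMatrix K (Fin.cons y x : Fin (k + 1) → Λ)).det =
      K y y * (kernelMatrix K x).det -
        ∑ i, ∑ j, (kernelMatrix K x).adjugate j i * (K (x i) y * K y (x j)) := by
  rw [det_bordered]
  rfl

theorem detIntensity_comp_perm (K : Λ → Λ → ℂ) {k : ℕ} (x : Fin k → Λ) (σ : Equiv.Perm (Fin k)) :
    detIntensity K k (x ∘ σ) = detIntensity K k x := by
  have : kernelMatrix K (x ∘ σ) = (kernelMatrix K x).submatrix σ σ := rfl
  rw [detIntensity, this, Matrix.det_submatrix_equiv_self, detIntensity]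

variable [MeasurableSpace Λ]

theorem measurable_detIntensity {K : Λ → Λ → ℂ} (hK : Measurable (Function.uncurry K)) (k : ℕ) :
    Measurable (detIntensity K k) := by
  unfold detIntensity
  refine (Complex.measurable_re.comp ?_).real_toNNReal
  simp only [Matrix.det_apply]
  refine Finset.measurable_sum _ fun σ _ => ?_
  refine Measurable.const_smul (Finset.measurable_prod _ fun i _ => ?_) _
  have h := (measurable_pi_apply (X := fun _ : Fin k => Λ) (σ i)).prodMk
    (measurable_pi_apply (X := fun _ : Fin k => Λ) i)
  exact hK.comp h

theorem measurable_orthKernel (hm : ∀ a, Measurable (ψ a)) :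
    Measurable (Function.uncurry (orthKernel ψ)) := by
  unfold orthKernel Function.uncurry
  refine Finset.measurable_sum _ fun a _ => ?_
  exact ((hm a).comp measurable_fst).mul
    (Complex.continuous_conj.measurable.comp ((hm a).comp measurable_snd))

variable {μ : Measure Λ}

/-- A finite orthonormal family of measurable square-integrable functions. -/
structure IsOrthonormalFamily (μ : Measure Λ) (ψ : Fin N → Λ → ℂ) : Prop where
  measurable : ∀ a, Measurable (ψ a)
  memLp : ∀ a, MemLp (ψ a) 2 μ
  integral : ∀ a b, ∫ x, ψ a x * conj (ψ b x) ∂μ = if a = b then 1 else 0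

theorem IsOrthonormalFamily.integrable_mul_conj (h : IsOrthonormalFamily μ ψ) (a b : Fin N) :
    Integrable (fun x => ψ a x * conj (ψ b x)) μ :=
  (h.memLp a).integrable_mul (h.memLp b).star

theorem IsOrthonormalFamily.integrable_orthKernel_mul (h : IsOrthonormalFamily μ ψ) (x z : Λ) :
    Integrable (fun y => orthKernel ψ x y * orthKernel ψ y z) μ := by
  simp only [orthKernel_mul_orthKernel]
  exact integrable_finsetSum _ fun a _ => integrable_finsetSum _ fun b _ =>
    (h.integrable_mul_conj b a).const_mul _

theorem IsOrthonormalFamily.integral_orthKernel_mul (h : IsOrthonormalFamily μ ψ) (x z : Λ) :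
    ∫ y, orthKernel ψ x y * orthKernel ψ y z ∂μ = orthKernel ψ x z := by
  simp only [orthKernel_mul_orthKernel]
  rw [integral_finsetSum _ fun a _ => integrable_finsetSum _ fun b _ =>
    (h.integrable_mul_conj b a).const_mul _]
  refine Finset.sum_congr rfl fun a _ => ?_
  rw [integral_finsetSum _ fun b _ => (h.integrable_mul_conj b a).const_mul _]
  simp [integral_const_mul, h.integral]

theorem IsOrthonormalFamily.integrable_orthKernel_diag (h : IsOrthonormalFamily μ ψ) :
    Integrable (fun y => orthKernel ψ y y) μ :=
  integrable_finsetSum _ fun a _ => h.integrable_mul_conj a a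

theorem IsOrthonormalFamily.integral_orthKernel_diag (h : IsOrthonormalFamily μ ψ) :
    ∫ y, orthKernel ψ y y ∂μ = N := by
  simp only [orthKernel]
  rw [integral_finsetSum _ fun a _ => h.integrable_mul_conj a a]
  simp [h.integral]

theorem IsOrthonormalFamily.integrable_det_cons (h : IsOrthonormalFamily μ ψ) {k : ℕ}
    (x : Fin k → Λ) : Integrable (fun y =>
      (kernelMatrix (orthKernel ψ) (Fin.cons y x : Fin (k + 1) → Λ)).det) μ := by
  simp only [det_kernelMatrix_cons]
  exact (h.integrable_orthKernel_diag.mul_const _).sub <|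
    integrable_finsetSum _ fun i _ => integrable_finsetSum _ fun j _ =>
      (h.integrable_orthKernel_mul _ _).const_mul _

/-- In the bordered expansion the corner integrates to N, while the reproducing property turns the
border products into entries of the kernel matrix, whose pairing with the adjugate is k times the
determinant. -/
theorem IsOrthonormalFamily.integral_det_cons (h : IsOrthonormalFamily μ ψ) {k : ℕ}
    (x : Fin k → Λ) :
    ∫ y, (kernelMatrix (orthKernel ψ) (Fin.cons y x : Fin (k + 1) → Λ)).det ∂μ =
      ((N : ℂ) - k) * (kernelMatrix (orthKernel ψ) x).det := by
  simp only [det_kernelMatrix_cons]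
  have hint : ∀ i j, Integrable (fun y => (kernelMatrix (orthKernel ψ) x).adjugate j i *
      (orthKernel ψ (x i) y * orthKernel ψ y (x j))) μ := fun i j =>
    (h.integrable_orthKernel_mul _ _).const_mul _
  rw [integral_sub (h.integrable_orthKernel_diag.mul_const _)
    (integrable_finsetSum _ fun i _ => integrable_finsetSum _ fun j _ => hint i j),
    integral_mul_const, h.integral_orthKernel_diag,
    integral_finsetSum _ fun i _ => integrable_finsetSum _ fun j _ => hint i j, sub_mul]
  congr 1
  have htr : ((kernelMatrix (orthKernel ψ) x) * (kernelMatrix (orthKernel ψ) x).adjugate).trace =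
      k * (kernelMatrix (orthKernel ψ) x).det := by
    rw [Matrix.mul_adjugate, Matrix.trace_smul, Matrix.trace_one, Fintype.card_fin, smul_eq_mul,
      mul_comm]
  rw [← htr, Matrix.trace]
  refine Finset.sum_congr rfl fun i _ => ?_
  rw [integral_finsetSum _ fun j _ => hint i j, Matrix.diag_apply, Matrix.mul_apply]
  refine Finset.sum_congr rfl fun j _ => ?_
  rw [integral_const_mul, h.integral_orthKernel_mul, mul_comm]
  rfl

theorem IsOrthonormalFamily.lintegral_detIntensity_cons (h : IsOrthonormalFamily μ ψ) {k : ℕ}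
    (x : Fin k → Λ) :
    ∫⁻ y, detIntensity (orthKernel ψ) (k + 1) (Fin.cons y x) ∂μ =
      ((N - k : ℕ) : ℝ≥0∞) * detIntensity (orthKernel ψ) k x := by
  have hre : ∀ (m : ℕ) (z : Fin m → Λ), (detIntensity (orthKernel ψ) m z : ℝ≥0∞) =
      ENNReal.ofReal ((kernelMatrix (orthKernel ψ) z).det.re) := fun m z => rfl
  have hnn : ∀ (m : ℕ) (z : Fin m → Λ), 0 ≤ (kernelMatrix (orthKernel ψ) z).det.re := by
    intro m z
    rw [← coe_detIntensity_orthKernel, Complex.ofReal_re]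
    exact NNReal.coe_nonneg _
  simp only [hre]
  have h2 := ofReal_integral_eq_lintegral_ofReal (h.integrable_det_cons x).re
    (Eventually.of_forall fun y => hnn _ _)
  simp only [RCLike.re_to_complex] at h2
  rw [← h2]
  have h1 := integral_re (h.integrable_det_cons x)
  rw [h.integral_det_cons] at h1
  simp only [RCLike.re_to_complex] at h1
  rw [h1]
  rcases le_or_gt k N with hk | hk
  · have : ((N : ℂ) - k) = (((N - k : ℕ) : ℝ) : ℂ) := by push_cast [Nat.cast_sub hk]; rfl
    rw [this, Complex.re_ofReal_mul, ENNReal.ofReal_mul (Nat.cast_nonneg _),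
      ENNReal.ofReal_natCast]
  -- For k > N the truncated difference N - k is 0, in agreement with the vanishing of the
  -- determinants.
  · simp [det_kernelMatrix_eq_zero_of_lt hk]

/-- The measure on `k`-tuples with density the joint intensity of order `k`. -/
def detMeasure (μ : Measure Λ) (K : Λ → Λ → ℂ) (k : ℕ) : Measure (Fin k → Λ) :=
  (Measure.pi fun _ => μ).withDensity fun x => detIntensity K k x

theorem IsOrthonormalFamily.measurable_coe_detIntensity (h : IsOrthonormalFamily μ ψ) (k : ℕ) :
    Measurable fun x => (detIntensity (orthKernel ψ) k x : ℝ≥0∞) :=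
  (measurable_detIntensity (measurable_orthKernel h.measurable) k).coe_nnreal_ennreal

theorem detMeasure_eq_zero_of_lt {k : ℕ} (hk : N < k) :
    detMeasure μ (orthKernel ψ) k = 0 := by
  have : (fun x : Fin k → Λ => (detIntensity (orthKernel ψ) k x : ℝ≥0∞)) = 0 := by
    ext x
    simp [detIntensity, det_kernelMatrix_eq_zero_of_lt hk]
  rw [detMeasure, this, withDensity_zero]

variable [SigmaFinite μ]

theorem IsOrthonormalFamily.map_tail_detMeasure (h : IsOrthonormalFamily μ ψ) (k : ℕ) :
    (detMeasure μ (orthKernel ψ) (k + 1)).map (fun x i => x (Fin.succ i)) =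
      ((N - k : ℕ) : ℝ≥0∞) • detMeasure μ (orthKernel ψ) k := by
  have htail : Measurable fun (x : Fin (k + 1) → Λ) i => x (Fin.succ i) :=
    measurable_pi_lambda _ fun i => measurable_pi_apply _
  ext s hs
  rw [Measure.map_apply htail hs, detMeasure, detMeasure, withDensity_apply _ (htail hs),
    Measure.smul_apply, withDensity_apply _ hs, ← lintegral_indicator (htail hs),
    ← lintegral_indicator hs]
  have he := (measurePreserving_piFinSuccAbove (fun _ : Fin (k + 1) => μ) 0).symm
  rw [← he.lintegral_comp_emb (MeasurableEquiv.measurableEmbedding _), lintegral_prod_symm]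
  · rw [smul_eq_mul, ← lintegral_const_mul _
      ((h.measurable_coe_detIntensity k).indicator hs)]
    refine lintegral_congr fun x => ?_
    have hcons : ∀ y, (MeasurableEquiv.piFinSuccAbove (fun _ => Λ) 0).symm (y, x) =
        (Fin.cons y x : Fin (k + 1) → Λ) := fun y => by
      simp [MeasurableEquiv.piFinSuccAbove]
      rfl
    by_cases hx : x ∈ s
    · rw [indicator_of_mem hx, ← h.lintegral_detIntensity_cons]
      refine lintegral_congr fun y => ?_
      rw [hcons, indicator_of_mem]
      simpa using hx
    · rw [indicator_of_notMem hx, mul_zero, ← lintegral_zero (μ := μ)]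
      refine lintegral_congr fun y => ?_
      rw [hcons, indicator_of_notMem]
      simpa using hx
  · exact (((h.measurable_coe_detIntensity (k + 1)).indicator (htail hs)).comp
      (MeasurableEquiv.measurable _)).aemeasurable

theorem IsOrthonormalFamily.map_perm_detMeasure (h : IsOrthonormalFamily μ ψ) {k : ℕ}
    (σ : Equiv.Perm (Fin k)) :
    (detMeasure μ (orthKernel ψ) k).map (fun x i => x (σ i)) = detMeasure μ (orthKernel ψ) k := by
  have hσ : Measurable fun (x : Fin k → Λ) i => x (σ i) :=
    measurable_pi_lambda _ fun i => measurable_pi_apply _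
  have he : MeasurePreserving (MeasurableEquiv.piCongrLeft (fun _ : Fin k => Λ) σ.symm)
      (Measure.pi fun _ => μ) (Measure.pi fun _ => μ) :=
    measurePreserving_piCongrLeft (fun _ : Fin k => μ) σ.symm
  have hfun : ⇑(MeasurableEquiv.piCongrLeft (fun _ : Fin k => Λ) σ.symm) = fun x i => x (σ i) := by
    ext x i
    obtain ⟨j, rfl⟩ := σ.symm.surjective i
    rw [MeasurableEquiv.piCongrLeft, MeasurableEquiv.coe_mk, Equiv.piCongrLeft_apply_apply,
      Equiv.apply_symm_apply]
  rw [hfun] at he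
  ext s hs
  rw [Measure.map_apply hσ hs, detMeasure, withDensity_apply _ (hσ hs), withDensity_apply _ hs,
    ← lintegral_indicator (hσ hs), ← lintegral_indicator hs,
    ← he.lintegral_comp ((h.measurable_coe_detIntensity k).indicator hs)]
  refine lintegral_congr fun x => ?_
  have hx : detIntensity (orthKernel ψ) k (fun i => x (σ i)) = detIntensity (orthKernel ψ) k x :=
    detIntensity_comp_perm _ x σ
  by_cases hs' : (fun i => x (σ i)) ∈ s
  · rw [indicator_of_mem hs', indicator_of_mem (by exact hs'), hx]
  · rw [indicator_of_notMem hs', indicator_of_notMem (by exact hs')]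

/-- Forgetting coordinates one at a time multiplies the constants N - k, N - k - 1, and so on. One
selection `j` is enough, since symmetry yields the others. -/
theorem IsOrthonormalFamily.exists_map_detMeasure (h : IsOrthonormalFamily μ ψ) (k m : ℕ) :
    ∃ j : Fin k → Fin (k + m), Function.Injective j ∧
      (detMeasure μ (orthKernel ψ) (k + m)).map (fun x i => x (j i)) =
        ((N - k).descFactorial m : ℝ≥0∞) • detMeasure μ (orthKernel ψ) k := by
  induction m with
  | zero => exact ⟨id, Function.injective_id, by simp⟩
  | succ m ih =>
    obtain ⟨j, hj, hjm⟩ := ih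
    refine ⟨fun i => Fin.succ (j i), (Fin.succ_injective _).comp hj, ?_⟩
    have h1 : Measurable fun (x : Fin (k + m) → Λ) i => x (j i) :=
      measurable_pi_lambda _ fun i => measurable_pi_apply _
    have h2 : Measurable fun (x : Fin (k + m + 1) → Λ) i => x (Fin.succ i) :=
      measurable_pi_lambda _ fun i => measurable_pi_apply _
    have h3 := Measure.map_map (μ := detMeasure μ (orthKernel ψ) (k + m + 1)) h1 h2
    rw [h.map_tail_detMeasure, Measure.map_smul, hjm, smul_smul] at h3
    refine h3.symm.trans ?_
    rw [Nat.descFactorial_succ, Nat.sub_sub]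
    push_cast
    rfl

theorem IsOrthonormalFamily.map_injective_detMeasure (h : IsOrthonormalFamily μ ψ) {k : ℕ}
    {j : Fin k → Fin N} (hj : Function.Injective j) :
    (detMeasure μ (orthKernel ψ) N).map (fun x i => x (j i)) =
      ((N - k).factorial : ℝ≥0∞) • detMeasure μ (orthKernel ψ) k := by
  have hk : k ≤ N := by simpa using Fintype.card_le_of_injective j hj
  obtain ⟨m, rfl⟩ := Nat.exists_eq_add_of_le hk
  obtain ⟨j₀, hj₀, h₀⟩ := h.exists_map_detMeasure k m
  -- Any two injective selections differ by a permutation of all the coordinates, under which the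
  -- measure is invariant.
  obtain ⟨σ, hσ⟩ := Equiv.Perm.exists_extending_pair j₀ j hj₀ hj
  have h1 : Measurable fun (x : Fin (k + m) → Λ) i => x (j₀ i) :=
    measurable_pi_lambda _ fun i => measurable_pi_apply _
  have h2 : Measurable fun (x : Fin (k + m) → Λ) i => x (σ i) :=
    measurable_pi_lambda _ fun i => measurable_pi_apply _
  have h3 := Measure.map_map (μ := detMeasure μ (orthKernel ψ) (k + m)) h1 h2
  rw [h.map_perm_detMeasure, h₀] at h3
  have h4 : (fun (x : Fin (k + m) → Λ) i => x (j i)) =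
      (fun (x : Fin (k + m) → Λ) i => x (j₀ i)) ∘ (fun (x : Fin (k + m) → Λ) i => x (σ i)) := by
    ext x i
    simp [hσ]
  rw [h4, ← h3, Nat.add_sub_cancel_left, Nat.descFactorial_self]

end ProjectionProcess

/-! ### The law of the random tuple and its joint intensities -/

section ProjectionProcess

variable {Λ : Type*} [MeasurableSpace Λ] {N : ℕ} {ψ : Fin N → Λ → ℂ} {μ : Measure Λ}

theorem sum_dirac_apply (x : Fin N → Λ) {A : Set Λ} (hA : MeasurableSet A) :
    (∑ i, Measure.dirac (x i)) A = ∑ i, A.indicator 1 (x i) := by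
  rw [Measure.finsetSum_apply]
  exact Finset.sum_congr rfl fun i _ => Measure.dirac_apply' _ hA

theorem sum_dirac_apply_of_injective {x : Fin N → Λ} (hx : Function.Injective x) {A : Set Λ}
    (hA : MeasurableSet A) :
    (∑ i, Measure.dirac (x i)) A = ((range x ∩ A).encard : ℝ≥0∞) := by
  classical
  have h1 : range x ∩ A = x '' ((Finset.univ.filter fun i => x i ∈ A : Finset (Fin N)) : Set _) := by
    ext y
    constructor
    · rintro ⟨⟨i, rfl⟩, hi⟩
      exact ⟨i, by simpa using hi, rfl⟩
    · rintro ⟨i, hi, rfl⟩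
      exact ⟨⟨i, rfl⟩, by simpa using hi⟩
  rw [sum_dirac_apply x hA, h1, hx.encard_image, Set.encard_coe_eq_coe_finsetCard,
    ENat.toENNReal_coe, Finset.card_filter, Nat.cast_sum]
  refine Finset.sum_congr rfl fun i _ => ?_
  by_cases hi : x i ∈ A <;> simp [hi]

theorem prod_sum_dirac_apply (x : Fin N → Λ) {k : ℕ} {D : Fin k → Set Λ}
    (hD : ∀ i, MeasurableSet (D i)) :
    ∏ i, (∑ l, Measure.dirac (x l)) (D i) =
      ∑ σ : Fin k → Fin N, ((fun (x : Fin N → Λ) i => x (σ i)) ⁻¹' Set.pi univ D).indicator 1 x := by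
  classical
  simp only [sum_dirac_apply x (hD _)]
  rw [Finset.prod_univ_sum, Fintype.piFinset_univ]
  refine Finset.sum_congr rfl fun σ _ => ?_
  by_cases h : ∀ i, x (σ i) ∈ D i
  · rw [indicator_of_mem (by simpa using h)]
    exact Finset.prod_eq_one fun i _ => indicator_of_mem (h i) _
  · rw [indicator_of_notMem (by simpa using h)]
    obtain ⟨i, hi⟩ := not_forall.1 h
    exact Finset.prod_eq_zero (Finset.mem_univ i) (indicator_of_notMem hi _)

/-- The law of the random tuple of points of the projection process. -/
def detLaw (μ : Measure Λ) (ψ : Fin N → Λ → ℂ) : Measure (Fin N → Λ) :=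
  (N.factorial : ℝ≥0∞)⁻¹ • detMeasure μ (orthKernel ψ) N

theorem IsOrthonormalFamily.ae_injective_detLaw (h : IsOrthonormalFamily μ ψ) :
    ∀ᵐ x ∂(detLaw μ ψ), Function.Injective x := by
  refine Measure.ae_smul_measure ?_ _
  rw [detMeasure, ae_withDensity_iff (h.measurable_coe_detIntensity N)]
  refine Eventually.of_forall fun x hx => ?_
  by_contra hinj
  simp [detIntensity, det_kernelMatrix_eq_zero_of_not_injective _ hinj] at hx

variable [SigmaFinite μ]

theorem detMeasure_zero_univ (K : Λ → Λ → ℂ) : detMeasure μ K 0 univ = 1 := by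
  have : (fun x : Fin 0 → Λ => (detIntensity K 0 x : ℝ≥0∞)) = 1 := by
    ext x
    simp [detIntensity, kernelMatrix]
  rw [detMeasure, this, withDensity_one, Measure.pi_univ]
  simp

/-- The marginal on no coordinates: the empty determinant is 1, so only the factor (N - 0)!
survives. -/
theorem IsOrthonormalFamily.detMeasure_univ (h : IsOrthonormalFamily μ ψ) :
    detMeasure μ (orthKernel ψ) N univ = (N.factorial : ℝ≥0∞) := by
  have h1 := h.map_injective_detMeasure (j := (Fin.elim0 : Fin 0 → Fin N))
    (Function.injective_of_subsingleton _)
  have h2 := congrArg (fun ν => ν univ) h1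
  simp only [Measure.smul_apply, detMeasure_zero_univ, smul_eq_mul, mul_one, Nat.sub_zero] at h2
  rwa [Measure.map_apply (measurable_pi_lambda _ fun i => i.elim0) .univ, preimage_univ] at h2

theorem IsOrthonormalFamily.isProbabilityMeasure_detLaw (h : IsOrthonormalFamily μ ψ) :
    IsProbabilityMeasure (detLaw μ ψ) := by
  refine ⟨?_⟩
  rw [detLaw, Measure.smul_apply, h.detMeasure_univ, smul_eq_mul,
    ENNReal.inv_mul_cancel (by exact_mod_cast N.factorial_ne_zero) (ENNReal.natCast_ne_top _)]

theorem IsOrthonormalFamily.lintegral_prod_sum_dirac (h : IsOrthonormalFamily μ ψ) {k : ℕ}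
    {D : Fin k → Set Λ} (hD : ∀ i, MeasurableSet (D i))
    (hdisj : Pairwise fun i j => Disjoint (D i) (D j)) :
    ∫⁻ x, ∏ i, (∑ l, Measure.dirac (x l)) (D i) ∂(detLaw μ ψ) =
      ∫⁻ x in Set.pi univ D, (detIntensity (orthKernel ψ) k x : ℝ≥0∞)
        ∂(Measure.pi fun _ : Fin k => μ) := by
  classical
  have hpi : MeasurableSet (Set.pi univ D) := MeasurableSet.univ_pi hD
  have hmeas : ∀ σ : Fin k → Fin N, Measurable fun (x : Fin N → Λ) i => x (σ i) := fun σ =>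
    measurable_pi_lambda _ fun i => measurable_pi_apply _
  rw [← withDensity_apply _ hpi]
  change _ = detMeasure μ (orthKernel ψ) k _
  simp only [prod_sum_dirac_apply _ hD]
  rw [lintegral_finsetSum _ fun σ _ => measurable_one.indicator (hmeas σ hpi)]
  -- The product of counts is a sum over all assignments of points to the sets. Disjointness of the
  -- sets excludes non-injective ones, and the N!/(N - k)! others all contribute the same amount.
  have hterm : ∀ σ : Fin k → Fin N,
      ∫⁻ x, ((fun (x : Fin N → Λ) i => x (σ i)) ⁻¹' Set.pi univ D).indicator 1 x ∂(detLaw μ ψ) =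
        if Function.Injective σ then (N.factorial : ℝ≥0∞)⁻¹ * ((N - k).factorial *
          detMeasure μ (orthKernel ψ) k (Set.pi univ D)) else 0 := by
    intro σ
    rw [lintegral_indicator_one (hmeas σ hpi)]
    split_ifs with hσ
    · rw [detLaw, Measure.smul_apply, ← Measure.map_apply (hmeas σ) hpi,
        h.map_injective_detMeasure hσ, Measure.smul_apply, smul_eq_mul, smul_eq_mul]
    · have : (fun (x : Fin N → Λ) i => x (σ i)) ⁻¹' Set.pi univ D = ∅ := by
        simp only [Function.Injective, not_forall] at hσ
        obtain ⟨i, j, hij, hne⟩ := hσ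
        refine eq_empty_of_forall_notMem fun x hx => ?_
        have hx' : ∀ i, x (σ i) ∈ D i := by simpa using hx
        exact Set.disjoint_left.1 (hdisj hne) (hx' i) (hij ▸ hx' j)
      rw [this, measure_empty]
  simp only [hterm]
  rw [← Finset.sum_filter, Finset.sum_const, nsmul_eq_mul]
  have hcard : (Finset.univ.filter fun σ : Fin k → Fin N => Function.Injective σ).card =
      N.descFactorial k := by
    rw [← Fintype.card_subtype, Fintype.card_congr (Equiv.subtypeInjectiveEquivEmbedding _ _),
      Fintype.card_embedding_eq, Fintype.card_fin, Fintype.card_fin]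
  rw [hcard]
  rcases le_or_gt k N with hk | hk
  · rw [← mul_assoc, ← mul_assoc, mul_right_comm _ (_ : ℝ≥0∞)⁻¹, ← Nat.cast_mul, mul_comm _ (N - k).factorial,
      Nat.factorial_mul_descFactorial hk,
      ENNReal.mul_inv_cancel (by exact_mod_cast N.factorial_ne_zero) (ENNReal.natCast_ne_top _),
      one_mul]
  · rw [detMeasure_eq_zero_of_lt hk]
    simp

end ProjectionProcess

/-- A finite orthonormal family is the source of a determinantal point process with as many points
as the family has members. -/
theorem IsOrthonormalFamily.exists_isDPP {Λ : Type} [TopologicalSpace Λ] [MeasurableSpace Λ]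
    {N : ℕ} {ψ : Fin N → Λ → ℂ} {μ : Measure Λ} [SigmaFinite μ]
    (h : IsOrthonormalFamily μ ψ) :
    ∃ (Ω : Type) (_ : MeasurableSpace Ω) (P : Measure Ω) (_ : IsProbabilityMeasure P)
      (X : Ω → Measure Λ), IsDPP P X μ (orthKernel ψ) ∧ ∀ᵐ ω ∂P, X ω univ = (N : ℝ≥0∞) := by
  refine ⟨Fin N → Λ, inferInstance, detLaw μ ψ, h.isProbabilityMeasure_detLaw,
    fun x => ∑ i, Measure.dirac (x i), ⟨⟨?_, ?_⟩, detIntensity (orthKernel ψ), ⟨?_, ?_, ?_⟩, ?_⟩, ?_⟩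
  · refine Measure.measurable_of_measurable_coe _ fun s hs => ?_
    simp only [sum_dirac_apply _ hs]
    exact Finset.measurable_sum _ fun i _ =>
      (measurable_one.indicator hs).comp (measurable_pi_apply i)
  · filter_upwards [h.ae_injective_detLaw] with x hx
    exact ⟨range x, fun C _ => (finite_range x).inter_of_left C,
      fun A hA => sum_dirac_apply_of_injective hx hA⟩
  · exact measurable_detIntensity (measurable_orthKernel h.measurable)
  · exact fun k D hD hdisj => h.lintegral_prod_sum_dirac hD hdisj
  · intro k x hx
    simp [detIntensity, det_kernelMatrix_eq_zero_of_not_injective _ hx]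
  · exact fun k x => (coe_detIntensity_orthKernel k x).symm
  · refine Eventually.of_forall fun x => ?_
    simp

/-! ### The Jacobian of the stereographic projection -/

section Cone

open EuclideanGeometry

variable {V : Type*} [NormedAddCommGroup V] [InnerProductSpace ℝ V]

/-- The part of `x` orthogonal to `v`. -/
def orthPart (v : V) : V →L[ℝ] V := ContinuousLinearMap.id ℝ V - (innerSL ℝ v).smulRight v

/-- The cone over the inverse stereographic projection with pole `v`: the point `y + t v`, with `y`
orthogonal to `v`, goes to the point at distance `t` on the ray through the projection of `y`. -/
def stereoCone (v x : V) : V := inner ℝ v x • inversion v √2 (orthPart v x)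

theorem orthPart_apply (v x : V) : orthPart v x = x - inner ℝ v x • v := by
  simp [orthPart]

theorem inner_orthPart {v : V} (hv : ‖v‖ = 1) (x : V) : inner ℝ v (orthPart v x) = 0 := by
  rw [orthPart_apply, inner_sub_right, inner_smul_right, real_inner_self_eq_norm_sq, hv]
  ring

theorem norm_orthPart_sub_sq {v : V} (hv : ‖v‖ = 1) (x : V) :
    ‖orthPart v x - v‖ ^ 2 = ‖orthPart v x‖ ^ 2 + 1 := by
  rw [norm_sub_sq_real, real_inner_comm, inner_orthPart hv, hv]
  ring

theorem orthPart_ne {v : V} (hv : ‖v‖ = 1) (x : V) : orthPart v x ≠ v := by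
  intro h
  have := norm_orthPart_sub_sq hv x
  rw [h, hv, sub_self, norm_zero] at this
  norm_num at this

/-- The scaling factor of the inverse stereographic projection. -/
theorem stereo_scale {v : V} (hv : ‖v‖ = 1) (x : V) :
    (√2 / dist (orthPart v x) v) ^ 2 = 2 / (‖orthPart v x‖ ^ 2 + 1) := by
  rw [div_pow, Real.sq_sqrt zero_le_two, dist_eq_norm, norm_orthPart_sub_sq hv]

/-- This is the same reflection as in the derivative of the inversion. Both terms of the product
rule for `stereoCone` therefore share it as a factor, and it does not affect the absolute Jacobian.
-/
theorem reflection_pole {v : V} (hv : ‖v‖ = 1) (x : V) :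
    (ℝ ∙ (orthPart v x - v))ᗮ.reflection v = inversion v √2 (orthPart v x) := by
  rw [Submodule.reflection_orthogonal_apply, Submodule.reflection_singleton_apply, inversion,
    stereo_scale hv, RCLike.ofReal_real_eq_id, id, norm_orthPart_sub_sq hv, inner_sub_left,
    real_inner_comm, inner_orthPart hv, real_inner_self_eq_norm_sq, hv, vsub_eq_sub, vadd_eq_add]
  module

theorem norm_inversion_orthPart {v : V} (hv : ‖v‖ = 1) (x : V) :
    ‖inversion v √2 (orthPart v x)‖ = 1 := by
  rw [← reflection_pole hv, LinearIsometryEquiv.norm_map, hv]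

/-- The derivative of `stereoCone`. -/
def stereoConeDeriv (v x : V) : V →L[ℝ] V :=
  ((ℝ ∙ (orthPart v x - v))ᗮ.reflection : V →L[ℝ] V) ∘L
    ((inner ℝ v x * (2 / (‖orthPart v x‖ ^ 2 + 1))) • orthPart v + (innerSL ℝ v).smulRight v)

theorem hasFDerivAt_stereoCone {v : V} (hv : ‖v‖ = 1) (x : V) :
    HasFDerivAt (stereoCone v) (stereoConeDeriv v x) x := by
  have h1 := (hasFDerivAt_inversion (R := √2) (orthPart_ne hv x)).comp x
    (orthPart v).hasFDerivAt
  have h2 := (innerSL ℝ v).hasFDerivAt (x := x) |>.smul h1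
  refine h2.congr_fderiv ?_
  ext a
  simp only [stereoConeDeriv, stereo_scale hv, add_apply,
    smul_apply, ContinuousLinearMap.comp_apply,
    ContinuousLinearMap.smulRight_apply, Function.comp_apply, map_add, map_smul,
    ContinuousLinearEquiv.coe_coe, innerSL_apply_apply, smul_smul, ← reflection_pole hv]
  rfl

theorem abs_det_stereoConeDeriv [FiniteDimensional ℝ V] {v : V} (hv : ‖v‖ = 1) {x : V}
    (hx : 0 < inner ℝ v x) :
    |(stereoConeDeriv v x).det| =
      (inner ℝ v x * (2 / (‖orthPart v x‖ ^ 2 + 1))) ^ (Module.finrank ℝ V - 1) := by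
  set c : ℝ := inner ℝ v x * (2 / (‖orthPart v x‖ ^ 2 + 1)) with hc
  have hc0 : c ≠ 0 := by positivity
  have hn : 0 < Module.finrank ℝ V := by
    have : Nontrivial V := ⟨v, 0, by rintro rfl; simp at hv⟩
    exact Module.finrank_pos
  -- The map is multiplication by c on the orthogonal complement of v and the identity on v. Written
  -- as c times a rank-one perturbation of the identity, it has determinant c^n · c⁻¹.
  have h1 : ((c • orthPart v + (innerSL ℝ v).smulRight v : V →L[ℝ] V) : V →ₗ[ℝ] V) =
      c • LinearMap.transvection ((c⁻¹ - 1) • (innerSL ℝ v : V →L[ℝ] ℝ).toLinearMap) v := by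
    ext a
    simp [LinearMap.transvection, orthPart_apply, smul_sub, smul_smul, sub_smul, hc0]
    module
  have h2 : ((stereoConeDeriv v x : V →L[ℝ] V) : V →ₗ[ℝ] V) =
      ((ℝ ∙ (orthPart v x - v))ᗮ.reflection.toLinearMap : V →ₗ[ℝ] V) ∘ₗ
        ((c • orthPart v + (innerSL ℝ v).smulRight v : V →L[ℝ] V) : V →ₗ[ℝ] V) := rfl
  rw [ContinuousLinearMap.det, h2, LinearMap.det_comp, h1, LinearMap.det_smul,
    LinearMap.transvection.det, abs_mul, Submodule.det_reflection, abs_pow, abs_neg, abs_one,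
    one_pow, one_mul]
  have h3 : (1 : ℝ) + ((c⁻¹ - 1) • (innerSL ℝ v : V →L[ℝ] ℝ).toLinearMap) v = c⁻¹ := by
    simp [hv]
  rw [h3, ← pow_sub_one_mul hn.ne' c, mul_assoc, mul_inv_cancel₀ hc0, mul_one,
    abs_of_pos (by positivity)]

end Cone

/-! ### Surface measure in stereographic coordinates -/

section Stereographic

variable {d : ℕ}

open EuclideanGeometry Pointwise

/-- The vector of `ℝ^{2d+1}` with given first `2d` coordinates (as a vector of `ℂ^d`) and given
height. -/
def sphereCoord (d : ℕ) : WithLp 2 (Cd d × ℝ) →ₗᵢ[ℝ] EuclideanSpace ℝ (Fin (2 * d + 1)) where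
  toFun p := WithLp.toLp 2 (Fin.snoc (α := fun _ => ℝ) (realCoord p.fst) p.snd)
  map_add' p q := by
    ext i
    refine Fin.lastCases ?_ (fun i => ?_) i
    · simp
    · simp only [PiLp.add_apply, Fin.snoc_castSucc, WithLp.add_fst, realCoord]
      split_ifs <;> simp
  map_smul' c p := by
    ext i
    refine Fin.lastCases ?_ (fun i => ?_) i
    · simp
    · simp only [PiLp.smul_apply, Fin.snoc_castSucc, WithLp.smul_fst, realCoord]
      split_ifs <;> simp
  norm_map' p := by
    rw [← sq_eq_sq₀ (norm_nonneg _) (norm_nonneg _), EuclideanSpace.norm_sq_eq,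
      Fin.sum_univ_castSucc, WithLp.prod_norm_sq_eq_of_L2, ← sum_realCoord_sq]
    simp

/-- `sphereCoord` as a measurable equivalence. -/
def sphereCoordEquiv (d : ℕ) : Cd d × ℝ ≃ᵐ EuclideanSpace ℝ (Fin (2 * d + 1)) :=
  (MeasurableEquiv.toLp 2 (Cd d × ℝ)).trans
    ((sphereCoord d).toLinearIsometryEquiv (by
      rw [(WithLp.linearEquiv 2 ℝ (Cd d × ℝ)).finrank_eq]
      simp [finrank_real_of_complex])).toMeasurableEquiv

theorem measurePreserving_sphereCoordEquiv :
    MeasurePreserving (sphereCoordEquiv d) volume volume :=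
  (WithLp.volume_preserving_toLp (Cd d) ℝ).trans (LinearIsometryEquiv.measurePreserving _)

theorem sphereCoordEquiv_apply (z : Cd d) (h : ℝ) :
    sphereCoordEquiv d (z, h) = sphereCoord d (WithLp.toLp 2 (z, h)) := rfl

/-- The north pole. -/
def northPole (d : ℕ) : EuclideanSpace ℝ (Fin (2 * d + 1)) :=
  EuclideanSpace.single (Fin.last (2 * d)) 1

theorem norm_northPole : ‖northPole d‖ = 1 := by simp [northPole]

theorem inner_northPole (x : EuclideanSpace ℝ (Fin (2 * d + 1))) :
    inner ℝ (northPole d) x = x (Fin.last (2 * d)) := by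
  simp [northPole, EuclideanSpace.inner_single_left]

theorem inner_northPole_sphereCoord (z : Cd d) (h : ℝ) :
    inner ℝ (northPole d) (sphereCoordEquiv d (z, h)) = h := by
  simp [inner_northPole, sphereCoordEquiv_apply, sphereCoord]

theorem orthPart_sphereCoord (z : Cd d) (h : ℝ) :
    orthPart (northPole d) (sphereCoordEquiv d (z, h)) = sphereCoordEquiv d (z, 0) := by
  rw [orthPart_apply, inner_northPole_sphereCoord]
  ext i
  refine Fin.lastCases ?_ (fun i => ?_) i
  · simp [sphereCoordEquiv_apply, sphereCoord, northPole]
  · simp [sphereCoordEquiv_apply, sphereCoord, northPole, Fin.castSucc_ne_last]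

theorem norm_sphereCoord_zero (z : Cd d) : ‖sphereCoordEquiv d (z, 0)‖ = ‖z‖ := by
  rw [sphereCoordEquiv_apply, LinearIsometry.norm_map,
    ← sq_eq_sq₀ (norm_nonneg _) (norm_nonneg _), WithLp.prod_norm_sq_eq_of_L2]
  simp

theorem inversion_sphereCoord (z : Cd d) :
    inversion (northPole d) √2 (sphereCoordEquiv d (z, 0)) = stereoInvVec z := by
  have h := stereo_scale norm_northPole (sphereCoordEquiv d (z, 0))
  rw [orthPart_sphereCoord, norm_sphereCoord_zero] at h
  rw [inversion, h]
  have hpos : ‖z‖ ^ 2 + 1 ≠ 0 := by positivity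
  ext i
  refine Fin.lastCases ?_ (fun i => ?_) i
  · simp [sphereCoordEquiv_apply, sphereCoord, northPole, stereoInvVec]
    field_simp
    ring
  · simp [sphereCoordEquiv_apply, sphereCoord, northPole, stereoInvVec, Fin.castSucc_ne_last]
    ring

theorem stereoCone_sphereCoord (z : Cd d) (h : ℝ) :
    stereoCone (northPole d) (sphereCoordEquiv d (z, h)) = h • stereoInvVec z := by
  rw [stereoCone, inner_northPole_sphereCoord, orthPart_sphereCoord, inversion_sphereCoord]

/-- The norm of the image recovers the height, and injectivity of the inversion recovers the
horizontal part. -/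
theorem injOn_stereoCone {V : Type*} [NormedAddCommGroup V] [InnerProductSpace ℝ V] {v : V}
    (hv : ‖v‖ = 1) : InjOn (stereoCone v) {x | 0 < inner ℝ v x} := by
  intro x hx y hy hxy
  have hn : ∀ z : V, 0 < inner ℝ v z → ‖stereoCone v z‖ = inner ℝ v z := fun z hz => by
    rw [stereoCone, norm_smul, norm_inversion_orthPart hv, mul_one, Real.norm_of_nonneg hz.le]
  have h1 : inner ℝ v x = inner ℝ v y := by rw [← hn x hx, ← hn y hy, hxy]
  rw [stereoCone, stereoCone, h1] at hxy
  have h2 := inversion_injective v (by positivity) (smul_right_injective V (ne_of_gt hy) hxy)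
  rwa [orthPart_apply, orthPart_apply, h1, sub_left_inj] at h2

theorem realCoord_even (z : Cd d) (j : Fin d) :
    realCoord z ⟨2 * (j : ℕ), by omega⟩ = (z j).re := by
  simp [realCoord]

theorem realCoord_odd (z : Cd d) (j : Fin d) :
    realCoord z ⟨2 * (j : ℕ) + 1, by omega⟩ = (z j).im := by
  have h1 : (2 * (j : ℕ) + 1) / 2 = j := by omega
  have h2 : (2 * (j : ℕ) + 1) % 2 = 1 := by omega
  simp [realCoord, h1, h2]

theorem stereo_stereoInv (z : Cd d) : stereo (stereoInv z) = z := by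
  have hpos : ‖z‖ ^ 2 + 1 ≠ 0 := by positivity
  have hlast : 1 - stereoInvVec z (Fin.last (2 * d)) = 2 / (‖z‖ ^ 2 + 1) := by
    simp only [stereoInvVec, Fin.snoc_last]
    field_simp
    ring
  have hcoord : ∀ i : Fin (2 * d), stereoInvVec z i.castSucc / (2 / (‖z‖ ^ 2 + 1)) =
      realCoord z i := fun i => by
    simp only [stereoInvVec, Fin.snoc_castSucc]
    field_simp
  ext j
  refine Complex.ext ?_ ?_
  · rw [← realCoord_even z j, ← hcoord, ← hlast]
    rfl
  · rw [← realCoord_odd z j, ← hcoord, ← hlast]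
    rfl

theorem continuous_stereoInv : Continuous (stereoInv : Cd d → Sph d) := by
  refine Continuous.subtype_mk ?_ _
  have h : (stereoInvVec : Cd d → _) = fun z =>
      inversion (northPole d) √2 (sphereCoord d (WithLp.toLp 2 (z, 0))) := by
    ext1 z
    rw [← inversion_sphereCoord, sphereCoordEquiv_apply]
  have hc : Continuous fun z : Cd d => sphereCoord d (WithLp.toLp 2 (z, (0 : ℝ))) :=
    (sphereCoord d).continuous.comp
      ((WithLp.prod_continuous_toLp 2 _ _).comp (continuous_id.prodMk continuous_const))
  rw [h]
  refine continuous_const.inversion continuous_const hc fun z => ?_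
  rw [← sphereCoordEquiv_apply, ← orthPart_sphereCoord z 0]
  exact orthPart_ne norm_northPole _

theorem realCoord_stereo (p : Sph d) (i : Fin (2 * d)) :
    realCoord (stereo p) i = p.1 i.castSucc / (1 - p.1 (Fin.last (2 * d))) := by
  rw [realCoord]
  split_ifs with h
  · have hi : (⟨2 * ((i : ℕ) / 2), by omega⟩ : Fin (2 * d + 1)) = i.castSucc :=
      Fin.ext (by simp; omega)
    simp only [stereo, hi]
  · have hi : (⟨2 * ((i : ℕ) / 2) + 1, by omega⟩ : Fin (2 * d + 1)) = i.castSucc :=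
      Fin.ext (by simp; omega)
    simp only [stereo, hi]

theorem sum_sq_sphere (p : Sph d) :
    ∑ i : Fin (2 * d), p.1 i.castSucc ^ 2 = 1 - p.1 (Fin.last (2 * d)) ^ 2 := by
  have h : ‖p.1‖ ^ 2 = 1 := by rw [norm_eq_of_mem_sphere p, one_pow]
  rw [EuclideanSpace.norm_sq_eq, Fin.sum_univ_castSucc] at h
  simp only [Real.norm_eq_abs, sq_abs] at h
  linarith

theorem height_ne_one {p : Sph d} (hp : p.1 ≠ northPole d) : 1 - p.1 (Fin.last (2 * d)) ≠ 0 := by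
  intro h
  have h1 : p.1 (Fin.last (2 * d)) = 1 := by linarith
  have h2 := sum_sq_sphere p
  rw [h1, one_pow, sub_self, Finset.sum_eq_zero_iff_of_nonneg fun i _ => sq_nonneg _] at h2
  refine hp ?_
  ext i
  refine Fin.lastCases ?_ (fun i => ?_) i
  · simp [northPole, h1]
  · simpa [northPole, Fin.castSucc_ne_last] using h2 i (Finset.mem_univ i)

theorem stereoInv_stereo {p : Sph d} (hp : p.1 ≠ northPole d) : stereoInv (stereo p) = p := by
  have hc := height_ne_one hp
  have hnorm : ‖stereo p‖ ^ 2 + 1 = 2 / (1 - p.1 (Fin.last (2 * d))) := by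
    rw [← sum_realCoord_sq]
    simp only [realCoord_stereo, div_pow]
    rw [← Finset.sum_div, sum_sq_sphere]
    field_simp
    ring
  refine Subtype.ext ?_
  ext i
  refine Fin.lastCases ?_ (fun i => ?_) i
  · have h2 : ‖stereo p‖ ^ 2 - 1 = 2 / (1 - p.1 (Fin.last (2 * d))) - 2 := by linarith
    simp only [stereoInv, stereoInvVec, Fin.snoc_last, hnorm, h2]
    field_simp
    ring
  · simp only [stereoInv, stereoInvVec, Fin.snoc_castSucc, hnorm, realCoord_stereo]
    field_simp

theorem stereoInvVec_ne_northPole (z : Cd d) : stereoInvVec z ≠ northPole d := by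
  intro h
  have h1 := congrArg (fun x => x (Fin.last (2 * d))) h
  simp only [stereoInvVec, Fin.snoc_last, northPole, PiLp.single_apply] at h1
  have hpos : ‖z‖ ^ 2 + 1 ≠ 0 := by positivity
  field_simp at h1
  norm_num at h1
  linarith

theorem image_stereoCone (A : Set (Sph d)) :
    stereoCone (northPole d) '' (sphereCoordEquiv d '' ((stereoInv ⁻¹' A) ×ˢ Ioo 0 1)) =
      Ioo (0 : ℝ) 1 • (((↑) : Sph d → EuclideanSpace ℝ (Fin (2 * d + 1))) '' A \ {northPole d}) := by
  ext x
  rw [Set.mem_smul, image_image]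
  constructor
  · rintro ⟨⟨z, h⟩, ⟨hz, hh⟩, rfl⟩
    exact ⟨h, hh, stereoInvVec z, ⟨⟨stereoInv z, hz, rfl⟩, stereoInvVec_ne_northPole z⟩,
      (stereoCone_sphereCoord z h).symm⟩
  · rintro ⟨h, hh, _, ⟨⟨p, hp, rfl⟩, hpn⟩, rfl⟩
    refine ⟨(stereo p, h), ⟨?_, hh⟩, ?_⟩
    · rwa [mem_preimage, stereoInv_stereo hpn]
    · refine (stereoCone_sphereCoord _ _).trans ?_
      exact congrArg (fun q : Sph d => h • q.1) (stereoInv_stereo hpn)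

/-- The surface measure in stereographic coordinates. -/
theorem map_stereoInv (hd : 1 ≤ d) :
    (volume.withDensity fun z : Cd d => ENNReal.ofReal ((2 / (‖z‖ ^ 2 + 1)) ^ (2 * d))).map
      stereoInv = surfaceMeasure d := by
  ext A hA
  have hB : MeasurableSet (stereoInv ⁻¹' A) := continuous_stereoInv.measurable hA
  set T : Set (Cd d × ℝ) := (stereoInv ⁻¹' A) ×ˢ Ioo 0 1 with hT
  have hTm : MeasurableSet T := hB.prod measurableSet_Ioo
  have hs : MeasurableSet (sphereCoordEquiv d '' T) :=
    (sphereCoordEquiv d).measurableEmbedding.measurableSet_image.2 hTm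
  have hpos : ∀ x ∈ sphereCoordEquiv d '' T, 0 < inner ℝ (northPole d) x := by
    rintro _ ⟨⟨z, h⟩, ⟨-, hh⟩, rfl⟩
    rw [inner_northPole_sphereCoord]
    exact hh.1
  -- The cone chart misses only the ray over the north pole. It lies on a line, which is a proper
  -- subspace since 2d + 1 > 1.
  have hnull : volume (Ioo (0 : ℝ) 1 • {northPole d}) = 0 := by
    refine measure_mono_null (t := ((ℝ ∙ northPole d : Submodule ℝ _) : Set _)) ?_
      (Measure.addHaar_submodule _ _ fun h => ?_)
    · rintro _ ⟨h, -, _, rfl, rfl⟩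
      exact Submodule.smul_mem _ _ (Submodule.mem_span_singleton_self _)
    · have h1 := finrank_span_singleton (K := ℝ) (v := northPole d)
        (norm_pos_iff.1 (by rw [norm_northPole]; exact one_pos))
      rw [h, finrank_top, finrank_euclideanSpace, Fintype.card_fin] at h1
      omega
  have hcone : volume (Ioo (0 : ℝ) 1 • (((↑) : Sph d → EuclideanSpace ℝ (Fin (2 * d + 1))) '' A)) =
      volume (stereoCone (northPole d) '' (sphereCoordEquiv d '' T)) := by
    rw [image_stereoCone]
    refine le_antisymm ?_ (measure_mono (Set.smul_subset_smul_left sdiff_subset))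
    set A' := ((↑) : Sph d → EuclideanSpace ℝ (Fin (2 * d + 1))) '' A
    calc volume (Ioo (0 : ℝ) 1 • A')
        ≤ volume (Ioo (0 : ℝ) 1 • (A' \ {northPole d}) ∪ Ioo (0 : ℝ) 1 • {northPole d}) := by
          rw [← Set.smul_union]
          exact measure_mono (Set.smul_subset_smul_left (by simp))
      _ ≤ volume (Ioo (0 : ℝ) 1 • (A' \ {northPole d})) := by
          refine (measure_union_le _ _).trans ?_
          rw [hnull, add_zero]
  have hvol : volume (stereoCone (northPole d) '' (sphereCoordEquiv d '' T)) =
      ∫⁻ p in T, ENNReal.ofReal ((p.2 * (2 / (‖p.1‖ ^ 2 + 1))) ^ (2 * d)) := by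
    rw [← setLIntegral_one, lintegral_image_eq_lintegral_abs_det_fderiv_mul volume hs
      (fun x _ => (hasFDerivAt_stereoCone norm_northPole x).hasFDerivWithinAt)
      ((injOn_stereoCone norm_northPole).mono hpos),
      ← measurePreserving_sphereCoordEquiv.setLIntegral_comp_emb
        (sphereCoordEquiv d).measurableEmbedding]
    refine setLIntegral_congr_fun hTm fun p hp => ?_
    obtain ⟨z, h⟩ := p
    have h0 := hpos _ (mem_image_of_mem _ hp)
    rw [abs_det_stereoConeDeriv norm_northPole h0, inner_northPole_sphereCoord,
      orthPart_sphereCoord, norm_sphereCoord_zero, finrank_euclideanSpace, Fintype.card_fin,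
      Nat.add_sub_cancel, mul_one]
  rw [Measure.map_apply continuous_stereoInv.measurable hA, withDensity_apply _ hB,
    surfaceMeasure, Measure.toSphere_apply' _ hA, hcone, hvol, finrank_euclideanSpace,
    Fintype.card_fin, hT, Measure.volume_eq_prod, ← Measure.prod_restrict]
  have hprod : ∀ p : Cd d × ℝ, ENNReal.ofReal ((p.2 * (2 / (‖p.1‖ ^ 2 + 1))) ^ (2 * d)) =
      ENNReal.ofReal ((2 / (‖p.1‖ ^ 2 + 1)) ^ (2 * d)) * ENNReal.ofReal (p.2 ^ (2 * d)) :=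
    fun p => by rw [mul_pow, mul_comm, ENNReal.ofReal_mul (by positivity)]
  simp only [hprod]
  rw [lintegral_prod_mul (f := fun z : Cd d => ENNReal.ofReal ((2 / (‖z‖ ^ 2 + 1)) ^ (2 * d)))
    (g := fun h : ℝ => ENNReal.ofReal (h ^ (2 * d))) (by fun_prop) (by fun_prop), mul_left_comm]
  -- The height integral cancels the dimension factor 2d + 1 in the definition of surface measure
  -- through cone volumes.
  have hint : ∫⁻ h in Ioo (0 : ℝ) 1, ENNReal.ofReal (h ^ (2 * d)) =
      ENNReal.ofReal (1 / (2 * d + 1)) := by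
    rw [Measure.restrict_congr_set Ioo_ae_eq_Ioc, ← ofReal_integral_eq_lintegral_ofReal
      (intervalIntegral.intervalIntegrable_pow _).1, ← intervalIntegral.integral_of_le zero_le_one]
    · simp
    · filter_upwards [ae_restrict_mem measurableSet_Ioc] with y hy
      exact pow_nonneg hy.1.le _
  rw [hint, ← ENNReal.ofReal_natCast, ← ENNReal.ofReal_mul (by positivity)]
  push_cast
  rw [mul_one_div_cancel (by positivity), ENNReal.ofReal_one, mul_one]

end Stereographic

/-! ### Polar coordinates and the radial change of variables -/

/-- Integration in polar coordinates. -/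
theorem lintegral_polar {E : Type*} [NormedAddCommGroup E] [NormedSpace ℝ E] [Nontrivial E]
    [FiniteDimensional ℝ E] [MeasurableSpace E] [BorelSpace E] (μ : Measure E)
    [μ.IsAddHaarMeasure] {f : E → ℝ≥0∞} (hf : Measurable f) :
    ∫⁻ x, f x ∂μ = ∫⁻ u : Metric.sphere (0 : E) 1, (∫⁻ r in Ioi (0 : ℝ),
      ENNReal.ofReal (r ^ (Module.finrank ℝ E - 1)) * f (r • u.1)) ∂μ.toSphere := by
  have h := μ.measurePreserving_homeomorphUnitSphereProd
  have h1 : ∫⁻ x, f x ∂μ = ∫⁻ x : ({0}ᶜ : Set E), f x ∂(μ.comap (↑)) := by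
    rw [lintegral_subtype_comap (measurableSet_singleton _).compl, restrict_compl_singleton]
  have h2 : ∀ x : ({0}ᶜ : Set E), f x = f ((homeomorphUnitSphereProd E x).2.1 •
      (homeomorphUnitSphereProd E x).1.1) := fun x => by
    have hx : ‖x.1‖ ≠ 0 := norm_ne_zero_iff.2 x.2
    simp [smul_smul, hx]
  have hfm : Measurable fun p : Metric.sphere (0 : E) 1 × Ioi (0 : ℝ) => f (p.2.1 • p.1.1) := by
    refine hf.comp ?_
    fun_prop
  rw [h1, lintegral_congr h2, h.lintegral_comp hfm, lintegral_prod _ hfm.aemeasurable]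
  refine lintegral_congr fun u => ?_
  have hu : Measurable fun r : Ioi (0 : ℝ) => f (r.1 • u.1) := by
    refine hf.comp ?_
    fun_prop
  rw [Measure.volumeIoiPow, lintegral_withDensity_eq_lintegral_mul _ (by fun_prop) hu]
  exact lintegral_subtype_comap measurableSet_Ioi
    (fun r : ℝ => ENNReal.ofReal (r ^ (Module.finrank ℝ E - 1)) * f (r • u.1))

section Radial

variable {d L : ℕ} {g : ℝ → ℝ}

theorem IsAdmissible.surjOn (hg : IsAdmissible g) : SurjOn g (Ioi 0) (Ioi 0) := by
  intro r hr
  have h1 : ∃ a ∈ Ioi (0 : ℝ), g a < r :=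
    ((eventually_mem_nhdsWithin).and (hg.tendsto_zero.eventually (gt_mem_nhds hr))).exists
  have h2 : ∃ b ∈ Ioi (0 : ℝ), r < g b :=
    ((eventually_gt_atTop 0).and (hg.tendsto_atTop.eventually_gt_atTop r)).exists
  obtain ⟨a, ha, har⟩ := h1
  obtain ⟨b, hb, hbr⟩ := h2
  exact isPreconnected_Ioi.intermediate_value ha hb hg.contDiffOn.continuousOn ⟨har.le, hbr.le⟩

theorem IsAdmissible.invFunOn_pos (hg : IsAdmissible g) {r : ℝ} (hr : 0 < r) :
    0 < Function.invFunOn g (Ioi 0) r :=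
  Function.invFunOn_mem (hg.surjOn hr)

theorem IsAdmissible.apply_invFunOn (hg : IsAdmissible g) {r : ℝ} (hr : 0 < r) :
    g (Function.invFunOn g (Ioi 0) r) = r :=
  Function.invFunOn_eq (hg.surjOn hr)

theorem IsAdmissible.invFunOn_apply (hg : IsAdmissible g) {t : ℝ} (ht : 0 < t) :
    Function.invFunOn g (Ioi 0) (g t) = t :=
  hg.strictMonoOn.injOn.leftInvOn_invFunOn ht

theorem IsAdmissible.image_Ioi (hg : IsAdmissible g) : g '' Ioi 0 = Ioi 0 :=
  Subset.antisymm (image_subset_iff.2 hg.pos) hg.surjOn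

theorem IsAdmissible.hasDerivAt (hg : IsAdmissible g) {t : ℝ} (ht : 0 < t) :
    HasDerivAt g (deriv g t) t :=
  ((hg.contDiffOn.differentiableOn one_ne_zero).differentiableAt (Ioi_mem_nhds ht)).hasDerivAt

theorem IsAdmissible.deriv_nonneg (hg : IsAdmissible g) {t : ℝ} (ht : 0 < t) :
    0 ≤ deriv g t := by
  have h := hg.strictMonoOn.monotoneOn.derivWithin_nonneg (x := t)
  rwa [derivWithin_of_isOpen isOpen_Ioi ht] at h

theorem radialMap_smul {r : ℝ} (hr : 0 < r) {u : Cd d} (hu : ‖u‖ = 1) :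
    radialMap g (r • u) = g r • u := by
  rw [radialMap, norm_smul, hu, mul_one, Real.norm_of_nonneg hr.le, smul_smul,
    div_mul_cancel₀ _ hr.ne']

theorem radialMapInv_smul {r : ℝ} (hr : 0 < r) {u : Cd d} (hu : ‖u‖ = 1) :
    radialMapInv g (r • u) = Function.invFunOn g (Ioi 0) r • u :=
  radialMap_smul (g := Function.invFunOn g (Ioi 0)) hr hu

theorem IsAdmissible.radialMapInv_radialMap (hg : IsAdmissible g) (x : Cd d) :
    radialMapInv g (radialMap g x) = x := by
  rcases eq_or_ne x 0 with rfl | hx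
  · simp [radialMap, radialMapInv]
  · have hn : 0 < ‖x‖ := norm_pos_iff.2 hx
    have hu : ‖‖x‖⁻¹ • x‖ = 1 := by rw [norm_smul, norm_inv, norm_norm, inv_mul_cancel₀ hn.ne']
    have hxu : x = ‖x‖ • (‖x‖⁻¹ • x) := by rw [smul_smul, mul_inv_cancel₀ hn.ne', one_smul]
    conv_lhs => rw [hxu]
    rw [radialMap_smul hn hu, radialMapInv_smul (hg.pos _ hn) hu, hg.invFunOn_apply hn, ← hxu]

/-- The values of `h` off (0, ∞) are arbitrary, so `h` itself need not be measurable; setting them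
to 0 makes it monotone on the whole line. -/
theorem measurable_indicator_Ioi_of_monotoneOn {h : ℝ → ℝ} (hm : MonotoneOn h (Ioi 0))
    (hpos : ∀ t ∈ Ioi (0 : ℝ), 0 ≤ h t) : Measurable ((Ioi 0).indicator h) := by
  refine Monotone.measurable fun s t hst => ?_
  by_cases hs : s ∈ Ioi (0 : ℝ)
  · have ht : t ∈ Ioi (0 : ℝ) := lt_of_lt_of_le hs hst
    rw [indicator_of_mem hs, indicator_of_mem ht]
    exact hm hs ht hst
  · rw [indicator_of_notMem hs]
    exact indicator_nonneg hpos t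

theorem measurable_radialMap {h : ℝ → ℝ} (hm : MonotoneOn h (Ioi 0))
    (hpos : ∀ t ∈ Ioi (0 : ℝ), 0 ≤ h t) : Measurable (radialMap h : Cd d → Cd d) := by
  have : (radialMap h : Cd d → Cd d) = fun x => ((Ioi 0).indicator h ‖x‖ / ‖x‖) • x := by
    ext1 x
    rcases eq_or_ne x 0 with rfl | hx
    · simp [radialMap]
    · rw [radialMap, indicator_of_mem (mem_Ioi.2 (norm_pos_iff.2 hx))]
  rw [this]
  have h1 := (measurable_indicator_Ioi_of_monotoneOn hm hpos).comp (measurable_norm (α := Cd d))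
  exact (h1.div measurable_norm).smul measurable_id

theorem IsAdmissible.measurable_radialMap (hg : IsAdmissible g) :
    Measurable (radialMap g : Cd d → Cd d) :=
  _root_.measurable_radialMap hg.strictMonoOn.monotoneOn fun t ht => (hg.pos t ht).le

theorem IsAdmissible.measurable_radialMapInv (hg : IsAdmissible g) :
    Measurable (radialMapInv g : Cd d → Cd d) := by
  refine _root_.measurable_radialMap (h := Function.invFunOn g (Ioi 0)) (fun r hr s hs hrs => ?_)
    fun r hr => (hg.invFunOn_pos hr).le
  rw [← hg.strictMonoOn.le_iff_le (hg.invFunOn_pos hr) (hg.invFunOn_pos hs),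
    hg.apply_invFunOn hr, hg.apply_invFunOn hs]
  exact hrs

/-- The square root of the Jacobian of the inverse of `toSph g`, at a point of norm `t`. -/
def jacobianRoot (d L : ℕ) (g : ℝ → ℝ) (t : ℝ) : ℝ :=
  radialWeight d L g t * (1 + t ^ 2) ^ (((d : ℝ) + L + 1) / 2) / 2 ^ d

theorem IsAdmissible.measurable_jacobianRoot_norm (hg : IsAdmissible g) (hd : 1 ≤ d) :
    Measurable fun z : Cd d => jacobianRoot d L g ‖z‖ := by
  have hg1 := measurable_indicator_Ioi_of_monotoneOn hg.strictMonoOn.monotoneOn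
    fun t ht => (hg.pos t ht).le
  set g₁ := (Ioi 0).indicator g with hg₁
  have : (fun z : Cd d => jacobianRoot d L g ‖z‖) = (fun t => ((g₁ t ^ 2 + 1) ^ d *
      t ^ ((d : ℝ) - 1 / 2)) / (√(deriv g t) * g₁ t ^ ((d : ℝ) - 1 / 2) *
        (1 + t ^ 2) ^ (((d : ℝ) + L + 1) / 2)) * (1 + t ^ 2) ^ (((d : ℝ) + L + 1) / 2) / 2 ^ d) ∘
      norm := by
    ext1 z
    rcases eq_or_ne z 0 with rfl | hz
    -- At the origin the factor t^{d-1/2} vanishes because d ≥ 1, so the arbitrary value `g 0` plays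
    -- no role.
    · have hd' : (d : ℝ) - 1 / 2 ≠ 0 := by
        have : (1 : ℝ) ≤ d := by exact_mod_cast hd
        linarith
      simp only [jacobianRoot, radialWeight, Function.comp_apply, norm_zero, Real.zero_rpow hd',
        mul_zero, zero_div, zero_mul]
    · simp only [jacobianRoot, radialWeight, Function.comp_apply, hg₁,
        indicator_of_mem (mem_Ioi.2 (norm_pos_iff.2 hz))]
  rw [this]
  refine Measurable.comp ?_ measurable_norm
  have hderiv : Measurable (deriv g) := measurable_deriv g
  fun_prop

theorem IsAdmissible.jacobianRoot_sq (hg : IsAdmissible g) (hd : 1 ≤ d) {t : ℝ} (ht : 0 < t)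
    (hg' : deriv g t ≠ 0) :
    (2 / (g t ^ 2 + 1)) ^ (2 * d) * jacobianRoot d L g t ^ 2 =
      t ^ (2 * d - 1) / (deriv g t * g t ^ (2 * d - 1)) := by
  have hgt : 0 < g t := hg.pos t ht
  have hpow : ∀ x : ℝ, 0 < x → (x ^ ((d : ℝ) - 1 / 2)) ^ 2 = x ^ (2 * d - 1) := fun x hx => by
    rw [← Real.rpow_natCast, ← Real.rpow_mul hx.le, ← Real.rpow_natCast]
    congr 1
    push_cast [Nat.cast_sub (show 1 ≤ 2 * d by omega)]
    ring
  have hA : (0 : ℝ) < (1 + t ^ 2) ^ (((d : ℝ) + L + 1) / 2) := by positivity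
  -- The polynomial weight cancels the one in `radialWeight`, so the result does not depend on L.
  have hR : jacobianRoot d L g t = ((g t ^ 2 + 1) ^ d * t ^ ((d : ℝ) - 1 / 2)) /
      (√(deriv g t) * g t ^ ((d : ℝ) - 1 / 2) * 2 ^ d) := by
    rw [jacobianRoot, radialWeight]
    have h1 : (0 : ℝ) < g t ^ ((d : ℝ) - 1 / 2) := by positivity
    have h2 : (0 : ℝ) < √(deriv g t) :=
      Real.sqrt_pos.2 (lt_of_le_of_ne (hg.deriv_nonneg ht) hg'.symm)
    field_simp
  have h3 : g t ^ 2 + 1 ≠ 0 := by positivity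
  rw [hR, div_pow _ _ 2, mul_pow, mul_pow, mul_pow, hpow t ht, hpow _ hgt,
    Real.sq_sqrt (hg.deriv_nonneg ht), div_pow, ← pow_mul, ← pow_mul, mul_comm d 2]
  field_simp

theorem IsAdmissible.map_radialMap (hg : IsAdmissible g)
    (hg' : ∀ᵐ t ∂(volume.restrict (Ioi (0 : ℝ))), deriv g t ≠ 0) (hd : 1 ≤ d) :
    (volume : Measure (Cd d)).map (radialMap g) = volume.withDensity fun y =>
      ENNReal.ofReal ((2 / (‖y‖ ^ 2 + 1)) ^ (2 * d)) *
        ENNReal.ofReal (jacobianRoot d L g ‖radialMapInv g y‖ ^ 2) := by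
  have : NeZero d := ⟨by omega⟩
  have hW : Measurable fun y : Cd d => ENNReal.ofReal ((2 / (‖y‖ ^ 2 + 1)) ^ (2 * d)) *
      ENNReal.ofReal (jacobianRoot d L g ‖radialMapInv g y‖ ^ 2) := by
    have h1 := (hg.measurable_jacobianRoot_norm (L := L) hd).comp
      (hg.measurable_radialMapInv (d := d))
    have h2 : Measurable fun y : Cd d => ENNReal.ofReal ((2 / (‖y‖ ^ 2 + 1)) ^ (2 * d)) := by
      fun_prop
    exact h2.mul (h1.pow_const 2).ennreal_ofReal
  have hdim : Module.finrank ℝ (Cd d) = 2 * d := by simp [finrank_real_of_complex]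
  ext A hA
  have hA' := hg.measurable_radialMap (d := d) hA
  rw [Measure.map_apply hg.measurable_radialMap hA, withDensity_apply _ hA,
    ← lintegral_indicator_one hA', ← lintegral_indicator hA,
    lintegral_polar volume (measurable_one.indicator hA'),
    lintegral_polar volume (hW.indicator hA), hdim]
  refine lintegral_congr fun u => ?_
  have hu : ‖u.1‖ = 1 := norm_eq_of_mem_sphere u
  -- Substituting r = g(t) from this side needs only the derivative and injectivity of `g`, with no
  -- regularity of its inverse.
  conv_rhs => rw [← hg.image_Ioi]
  rw [lintegral_image_eq_lintegral_abs_deriv_mul measurableSet_Ioi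
    (fun t ht => (hg.hasDerivAt ht).hasDerivWithinAt) hg.strictMonoOn.injOn]
  refine lintegral_congr_ae ?_
  -- Where g' = 0 the factor |g'| kills the right-hand side but not the left, so the hypothesis on
  -- g' is essential here.
  filter_upwards [hg', ae_restrict_mem measurableSet_Ioi] with t ht' ht
  have hgt : 0 < g t := hg.pos t ht
  have hind : (radialMap g ⁻¹' A).indicator (1 : Cd d → ℝ≥0∞) (t • u.1) =
      A.indicator 1 (g t • u.1) := by
    rw [← radialMap_smul ht hu]
    rfl
  rw [hind]
  by_cases hmem : g t • u.1 ∈ A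
  · rw [indicator_of_mem hmem, indicator_of_mem hmem, radialMapInv_smul hgt hu,
      hg.invFunOn_apply ht, norm_smul, norm_smul, hu, mul_one, mul_one,
      Real.norm_of_nonneg hgt.le, Real.norm_of_nonneg (le_of_lt ht),
      ← ENNReal.ofReal_mul (by positivity), hg.jacobianRoot_sq hd ht ht',
      abs_of_nonneg (hg.deriv_nonneg ht), ← ENNReal.ofReal_mul (by positivity),
      ← ENNReal.ofReal_mul (hg.deriv_nonneg ht), Pi.one_apply, mul_one]
    congr 1
    field_simp
  · rw [indicator_of_notMem hmem, indicator_of_notMem hmem]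
    simp

end Radial

/-! ### Push-forward of determinantal processes -/

section PushForward

/-- Tonelli's theorem for a product of functions of one variable each. -/
theorem lintegral_fin_prod {Λ : Type*} [MeasurableSpace Λ] {k : ℕ} (μ : Fin k → Measure Λ)
    [∀ i, SigmaFinite (μ i)] {f : Fin k → Λ → ℝ≥0∞} (hf : ∀ i, Measurable (f i)) :
    ∫⁻ x, ∏ i, f i (x i) ∂(Measure.pi μ) = ∏ i, ∫⁻ y, f i y ∂(μ i) := by
  induction k with
  | zero => simp
  | succ k ih =>
    have he := (measurePreserving_piFinSuccAbove μ 0).symm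
    rw [← he.lintegral_comp_emb (MeasurableEquiv.measurableEmbedding _), Fin.prod_univ_succ,
      ← ih (fun i => μ (Fin.succ i)) (f := fun i => f (Fin.succ i)) (fun i => hf (Fin.succ i))]
    have hcons : ∀ p : Λ × (Fin k → Λ), ∏ i, f i
        ((MeasurableEquiv.piFinSuccAbove (fun _ => Λ) 0).symm p i) =
        f 0 p.1 * ∏ i : Fin k, f i.succ (p.2 i) := fun p => by
      rw [Fin.prod_univ_succ]
      rfl
    simp only [hcons]
    exact lintegral_prod_mul (hf 0).aemeasurable
      (Finset.measurable_prod _ fun (i : Fin k) _ => (hf i.succ).comp (measurable_pi_apply i)).aemeasurable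

/-- Finite values of `w` keep the weighted measure σ-finite, as product measures require. -/
theorem pi_withDensity {Λ : Type*} [MeasurableSpace Λ] {k : ℕ} (μ : Measure Λ) [SigmaFinite μ]
    {w : Λ → ℝ≥0} (hw : Measurable w) :
    (Measure.pi fun _ : Fin k => μ.withDensity fun y => (w y : ℝ≥0∞)) =
      (Measure.pi fun _ : Fin k => μ).withDensity fun x => ∏ i, (w (x i) : ℝ≥0∞) := by
  refine Measure.pi_eq fun s hs => ?_
  rw [withDensity_apply _ (MeasurableSet.univ_pi hs), Measure.restrict_pi_pi,
    lintegral_fin_prod _ fun i => hw.coe_nnreal_ennreal]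
  exact Finset.prod_congr rfl fun i _ => (withDensity_apply _ (hs i)).symm

/-- Finite mass is required because `T` is not proper: the image of an infinite locally finite set
may accumulate, as at the north pole. -/
theorem IsSimpleCountingMeasure.map {Λ Λ' : Type*} [TopologicalSpace Λ] [MeasurableSpace Λ]
    [TopologicalSpace Λ'] [MeasurableSpace Λ'] {m : Measure Λ} (hm : IsSimpleCountingMeasure m)
    (hfin : m univ ≠ ∞) {T : Λ → Λ'} (hT : Measurable T) (hinj : Function.Injective T) :
    IsSimpleCountingMeasure (m.map T) := by
  obtain ⟨S, -, hS⟩ := hm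
  have hSfin : S.Finite := by
    rw [hS _ .univ, inter_univ] at hfin
    rw [← Set.encard_lt_top_iff, lt_top_iff_ne_top]
    rintro h
    simp [h] at hfin
  refine ⟨T '' S, fun C _ => (hSfin.image T).inter_of_left C, fun A hA => ?_⟩
  rw [Measure.map_apply hT hA, hS _ (hT hA), ← hinj.encard_image, image_inter_preimage]

variable {Ω Λ Λ' : Type*} [MeasurableSpace Ω] [TopologicalSpace Λ] [MeasurableSpace Λ]
  [TopologicalSpace Λ'] [MeasurableSpace Λ'] {P : Measure Ω} {X : Ω → Measure Λ}
  {μ : Measure Λ} [SigmaFinite μ] {μ' : Measure Λ'} [SigmaFinite μ'] {K : Λ → Λ → ℂ}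

/-- The push-forward of a determinantal point process under an injective map. -/
theorem IsDPP.map (hX : IsDPP P X μ K) (hfin : ∀ᵐ ω ∂P, X ω univ ≠ ∞) {T : Λ → Λ'} {S : Λ' → Λ}
    (hT : Measurable T) (hS : Measurable S) (hST : Function.LeftInverse S T) {s : Λ' → ℝ}
    (hs : Measurable s)
    (hμ : μ.map T = μ'.withDensity fun p => ((s p ^ 2).toNNReal : ℝ≥0∞)) :
    IsDPP P (fun ω => (X ω).map T) μ' fun p q => s p * (s q * K (S p) (S q)) := by
  obtain ⟨⟨hXm, hXs⟩, ρ, ⟨hρm, hρ, hdiag⟩, hdet⟩ := hX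
  have hw : Measurable fun p => (s p ^ 2).toNNReal := (hs.pow_const 2).real_toNNReal
  have : SigmaFinite (μ.map T) := by
    rw [hμ]
    exact SigmaFinite.withDensity _
  have hSk : ∀ k, Measurable fun (p : Fin k → Λ') i => S (p i) := fun k =>
    measurable_pi_lambda _ fun i => hS.comp (measurable_pi_apply i)
  have hTk : ∀ k, Measurable fun (x : Fin k → Λ) i => T (x i) := fun k =>
    measurable_pi_lambda _ fun i => hT.comp (measurable_pi_apply i)
  have hwk : ∀ k, Measurable fun p : Fin k → Λ' => ∏ i, (s (p i) ^ 2).toNNReal := fun k =>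
    Finset.measurable_prod _ fun i _ => hw.comp (measurable_pi_apply i)
  refine ⟨⟨(Measure.measurable_map T hT).comp hXm, ?_⟩,
    fun k p => (∏ i, (s (p i) ^ 2).toNNReal) * ρ k fun i => S (p i), ⟨fun k => ?_, ?_, ?_⟩, ?_⟩
  · filter_upwards [hXs, hfin] with ω h1 h2
    exact h1.map h2 hT hST.injective
  · exact (hwk k).mul ((hρm k).comp (hSk k))
  · intro k D hD hdisj
    have hDk : MeasurableSet (Set.pi univ D) := MeasurableSet.univ_pi hD
    have h1 := hρ k (fun i => T ⁻¹' D i) (fun i => hT (hD i))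
      fun i j hij => (hdisj hij).preimage T
    simp only [Measure.map_apply hT (hD _)]
    rw [h1]
    have hpre : (Set.pi univ fun i => T ⁻¹' D i) =
        (fun (x : Fin k → Λ) i => T (x i)) ⁻¹' Set.pi univ D := by
      ext x
      simp
    have hρS : Measurable fun p : Fin k → Λ' => (ρ k fun i => S (p i) : ℝ≥0∞) :=
      ((hρm k).comp (hSk k)).coe_nnreal_ennreal
    have hpi : (Measure.pi fun _ : Fin k => μ).map (fun x i => T (x i)) =
        (Measure.pi fun _ : Fin k => μ').withDensity
          fun p => ∏ i, ((s (p i) ^ 2).toNNReal : ℝ≥0∞) := by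
      rw [Measure.pi_map_pi (fun _ => hT.aemeasurable), hμ, pi_withDensity _ hw]
    have hwk' : Measurable fun p : Fin k → Λ' => ∏ i, ((s (p i) ^ 2).toNNReal : ℝ≥0∞) :=
      Finset.measurable_prod _ fun i _ => hw.coe_nnreal_ennreal.comp (measurable_pi_apply i)
    calc ∫⁻ x in Set.pi univ fun i => T ⁻¹' D i, (ρ k x : ℝ≥0∞) ∂(Measure.pi fun _ => μ)
        = ∫⁻ x in (fun (x : Fin k → Λ) i => T (x i)) ⁻¹' Set.pi univ D,
            (ρ k fun i => S (T (x i)) : ℝ≥0∞) ∂(Measure.pi fun _ => μ) := by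
          simp only [hST _, hpre]
      _ = ∫⁻ p in Set.pi univ D, (ρ k fun i => S (p i) : ℝ≥0∞)
            ∂((Measure.pi fun _ : Fin k => μ).map (fun x i => T (x i))) :=
          (setLIntegral_map hDk hρS (hTk k)).symm
      _ = _ := by
          rw [hpi, setLIntegral_withDensity_eq_setLIntegral_mul _ hwk' hρS hDk]
          refine lintegral_congr fun p => ?_
          rw [Pi.mul_apply, ENNReal.coe_mul, ENNReal.ofNNReal_finsetProd]
  · intro k p hp
    rw [hdiag k _ fun hinj => hp fun i j hij => hinj (congrArg S hij), mul_zero]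
  · intro k p
    -- Rows and columns each give one factor ∏ s(p_i); together they form the density of the image
    -- product measure.
    have h1 : (Matrix.of fun i j => (s (p i) : ℂ) * ((s (p j) : ℂ) * K (S (p i)) (S (p j)))).det =
        (∏ i, (s (p i) : ℂ)) * ((∏ i, (s (p i) : ℂ)) *
          (Matrix.of fun i j => K (S (p i)) (S (p j))).det) := by
      rw [← Matrix.det_mul_row, ← Matrix.det_mul_column]
      rfl
    rw [h1, hdet k fun i => S (p i), NNReal.coe_mul, NNReal.coe_prod]
    simp only [Real.coe_toNNReal _ (sq_nonneg _)]
    push_cast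
    rw [Finset.prod_pow]
    ring

end PushForward

theorem measurable_stereo {d : ℕ} : Measurable (stereo : Sph d → Cd d) := by
  have hc : ∀ i, Measurable fun p : Sph d => p.1 i := fun i =>
    (measurable_pi_apply i).comp ((WithLp.measurable_ofLp 2 _).comp measurable_subtype_coe)
  refine (WithLp.measurable_toLp 2 _).comp (measurable_pi_lambda _ fun j => ?_)
  have h : ∀ a b : Sph d → ℝ, Measurable a → Measurable b →
      Measurable fun p => (⟨a p, b p⟩ : ℂ) := fun a b ha hb =>
    Complex.measurableEquivRealProd.symm.measurable.comp (ha.prodMk hb)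
  exact h _ _ ((hc _).div (measurable_const.sub (hc _))) ((hc _).div (measurable_const.sub (hc _)))

/-! ### The Jacobian of the composite map to the sphere -/

section Sphere

variable {d L : ℕ} {g : ℝ → ℝ}

theorem IsAdmissible.measurable_toSph (hg : IsAdmissible g) :
    Measurable (toSph g : Cd d → Sph d) :=
  continuous_stereoInv.measurable.comp hg.measurable_radialMap

theorem IsAdmissible.leftInverse_toSph (hg : IsAdmissible g) :
    Function.LeftInverse (fun p : Sph d => radialMapInv g (stereo p)) (toSph g) := fun x => by
  change radialMapInv g (stereo (stereoInv (radialMap g x))) = x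
  rw [stereo_stereoInv, hg.radialMapInv_radialMap]

theorem IsAdmissible.measurable_jacobianRoot_sphere (hg : IsAdmissible g) (hd : 1 ≤ d) :
    Measurable fun p : Sph d => jacobianRoot d L g ‖radialMapInv g (stereo p)‖ :=
  (hg.measurable_jacobianRoot_norm hd).comp (hg.measurable_radialMapInv.comp measurable_stereo)

theorem IsAdmissible.map_toSph (hg : IsAdmissible g)
    (hg' : ∀ᵐ t ∂(volume.restrict (Ioi (0 : ℝ))), deriv g t ≠ 0) (hd : 1 ≤ d) :
    (volume : Measure (Cd d)).map (toSph g) = (surfaceMeasure d).withDensity fun p =>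
      ((jacobianRoot d L g ‖radialMapInv g (stereo p)‖ ^ 2).toNNReal : ℝ≥0∞) := by
  have hw : Measurable fun p : Sph d =>
      ((jacobianRoot d L g ‖radialMapInv g (stereo p)‖ ^ 2).toNNReal : ℝ≥0∞) :=
    ((hg.measurable_jacobianRoot_sphere hd).pow_const 2).ennreal_ofReal
  have hl : Measurable fun z : Cd d => ENNReal.ofReal ((2 / (‖z‖ ^ 2 + 1)) ^ (2 * d)) := by
    fun_prop
  have hmap : (volume : Measure (Cd d)).map (toSph g) =
      ((volume : Measure (Cd d)).map (radialMap g)).map stereoInv :=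
    (Measure.map_map continuous_stereoInv.measurable hg.measurable_radialMap).symm
  rw [hmap, hg.map_radialMap (L := L) hg' hd, ← map_stereoInv hd]
  ext A hA
  have hB : MeasurableSet (stereoInv ⁻¹' A) := continuous_stereoInv.measurable hA
  rw [Measure.map_apply continuous_stereoInv.measurable hA, withDensity_apply _ hB,
    withDensity_apply _ hA, setLIntegral_map hA hw continuous_stereoInv.measurable]
  refine Eq.trans ?_ (setLIntegral_withDensity_eq_setLIntegral_mul _ hl
    (hw.comp continuous_stereoInv.measurable) hB).symm
  refine lintegral_congr fun z => ?_
  simp only [Pi.mul_apply, Function.comp_apply, stereo_stereoInv]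
  rfl

end Sphere

/-! ### Norms of the weighted monomials -/

section MonomialIntegrals

theorem lintegral_ofReal_of_integral_eq {α : Type*} [MeasurableSpace α] {μ : Measure α}
    {f : α → ℝ} (hf : 0 ≤ᵐ[μ] f) {c : ℝ} (hc : c ≠ 0) (h : ∫ x, f x ∂μ = c) :
    ∫⁻ x, ENNReal.ofReal (f x) ∂μ = ENNReal.ofReal c := by
  have hint : Integrable f μ := by
    -- The Bochner integral of a non-integrable function is 0 by convention, so a nonzero value
    -- forces integrability.
    by_contra hn
    exact hc (h.symm.trans (integral_undef hn))
  rw [← h, ofReal_integral_eq_lintegral_ofReal hint hf]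

theorem lintegral_pow_mul_exp (n : ℕ) {x : ℝ} (hx : 0 < x) :
    ∫⁻ s in Ioi (0 : ℝ), ENNReal.ofReal (s ^ n * Real.exp (-(x * s))) =
      ENNReal.ofReal (n.factorial / x ^ (n + 1)) := by
  refine lintegral_ofReal_of_integral_eq ?_ (by positivity) ?_
  · filter_upwards [ae_restrict_mem measurableSet_Ioi] with s hs
    have : (0 : ℝ) < s := hs
    show 0 ≤ s ^ n * _
    positivity
  · have h := Real.integral_rpow_mul_exp_neg_mul_Ioi (a := n + 1) (by positivity) hx
    simp only [add_sub_cancel_right, Real.rpow_natCast] at h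
    rw [h, Real.Gamma_nat_eq_factorial, ← Nat.cast_succ, Real.rpow_natCast, div_pow, one_pow,
      one_div_mul_eq_div]

theorem lintegral_norm_pow_mul_exp (n : ℕ) {s : ℝ} (hs : 0 < s) :
    ∫⁻ w : ℂ, ENNReal.ofReal (‖w‖ ^ (2 * n) * Real.exp (-(s * ‖w‖ ^ 2))) =
      ENNReal.ofReal (Real.pi * n.factorial / s ^ (n + 1)) := by
  refine lintegral_ofReal_of_integral_eq (Eventually.of_forall fun w => by positivity)
    (by positivity) ?_
  have h := Complex.integral_rpow_mul_exp_neg_mul_rpow (p := 2) (q := (2 * n : ℕ)) (b := s)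
    one_le_two (by have : (0 : ℝ) ≤ (2 * n : ℕ) := Nat.cast_nonneg _
                   linarith) hs
  have h1 : ((2 * n : ℕ) + 2 : ℝ) / 2 = (n + 1 : ℕ) := by push_cast; ring
  simp only [Real.rpow_natCast, Real.rpow_two, neg_mul, neg_div, h1] at h
  rw [h, Real.rpow_neg hs.le, Real.rpow_natCast]
  push_cast
  rw [Real.Gamma_nat_eq_factorial]
  field_simp

variable {d : ℕ}

/-- Both sides are Haar measures, hence proportional, and the Gaussian integral π^d shows that the
constant is 1. -/
theorem map_ofLp_volume :
    (volume : Measure (Cd d)).map WithLp.ofLp = (Measure.pi fun _ : Fin d => volume) := by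
  have hmeas : Measurable (WithLp.ofLp : Cd d → Fin d → ℂ) := WithLp.measurable_ofLp 2 _
  have hh : ((volume : Measure (Cd d)).map WithLp.ofLp).IsAddHaarMeasure :=
    (PiLp.continuousLinearEquiv 2 ℝ (fun _ : Fin d => ℂ)).isAddHaarMeasure_map volume
  have h1 := Measure.isAddLeftInvariant_eq_smul ((volume : Measure (Cd d)).map WithLp.ofLp)
    (Measure.pi fun _ : Fin d => (volume : Measure ℂ))
  set c := Measure.addHaarScalarFactor ((volume : Measure (Cd d)).map WithLp.ofLp)
    (Measure.pi fun _ : Fin d => (volume : Measure ℂ))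
  have hG : ∀ i : Fin d, Measurable fun w : ℂ => ENNReal.ofReal (Real.exp (-‖w‖ ^ 2)) := fun i => by
    fun_prop
  have h2 : ∫⁻ x : Fin d → ℂ, ∏ i, ENNReal.ofReal (Real.exp (-‖x i‖ ^ 2))
      ∂((volume : Measure (Cd d)).map WithLp.ofLp) = ENNReal.ofReal (Real.pi ^ d) := by
    rw [lintegral_map (by fun_prop) hmeas]
    have h3 : ∀ z : Cd d, ∏ i, ENNReal.ofReal (Real.exp (-‖z i‖ ^ 2)) =
        ENNReal.ofReal (Real.exp (-1 * ‖z‖ ^ 2)) := fun z => by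
      rw [← ENNReal.ofReal_prod_of_nonneg fun i _ => (Real.exp_pos _).le, ← Real.exp_sum,
        Finset.sum_neg_distrib, ← EuclideanSpace.norm_sq_eq, neg_one_mul]
    simp only [h3]
    refine lintegral_ofReal_of_integral_eq (Eventually.of_forall fun z => (Real.exp_pos _).le)
      (by positivity) ?_
    rw [GaussianFourier.integral_rexp_neg_mul_sq_norm one_pos, div_one, finrank_real_of_complex,
      finrank_euclideanSpace, Fintype.card_fin]
    push_cast
    rw [mul_div_cancel_left₀ _ two_ne_zero, Real.rpow_natCast]
  have h4 : ∫⁻ x : Fin d → ℂ, ∏ i, ENNReal.ofReal (Real.exp (-‖x i‖ ^ 2))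
      ∂(Measure.pi fun _ : Fin d => (volume : Measure ℂ)) = ENNReal.ofReal (Real.pi ^ d) := by
    rw [lintegral_fin_prod _ hG]
    have h5 := lintegral_norm_pow_mul_exp 0 one_pos
    simp only [mul_zero, pow_zero, one_mul, Nat.factorial_zero, Nat.cast_one, mul_one, zero_add,
      one_pow, div_one] at h5
    rw [h5, Finset.prod_const, Finset.card_univ, Fintype.card_fin, ENNReal.ofReal_pow Real.pi_pos.le]
  rw [h1, lintegral_smul_measure, h4] at h2
  have hc : c = 1 := by
    have h6 : (ENNReal.ofReal (Real.pi ^ d)) ≠ 0 := by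
      rw [Ne, ENNReal.ofReal_eq_zero, not_le]
      positivity
    have h7 : (c : ℝ≥0∞) * ENNReal.ofReal (Real.pi ^ d) = 1 * ENNReal.ofReal (Real.pi ^ d) := by
      rw [one_mul]
      exact h2
    exact_mod_cast (ENNReal.mul_left_inj h6 ENNReal.ofReal_ne_top).1 h7
  rw [h1, hc, one_smul]

theorem lintegral_Cd_prod {f : Fin d → ℂ → ℝ≥0∞} (hf : ∀ i, Measurable (f i)) :
    ∫⁻ z : Cd d, ∏ i, f i (z i) = ∏ i, ∫⁻ w, f i w := by
  have hm : Measurable fun x : Fin d → ℂ => ∏ i, f i (x i) :=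
    Finset.measurable_prod _ fun i _ => (hf i).comp (measurable_pi_apply i)
  rw [← lintegral_fin_prod _ hf, ← map_ofLp_volume, lintegral_map hm (WithLp.measurable_ofLp 2 _)]

/-- The squared norms of the weighted monomials. -/
theorem lintegral_monomial {L : ℕ} {α : Fin d → ℕ} (hα : ∑ i, α i ≤ L) :
    ∫⁻ z : Cd d, ENNReal.ofReal ((∏ i, ‖z i‖ ^ (2 * α i)) / (1 + ‖z‖ ^ 2) ^ (d + L + 1)) =
      ENNReal.ofReal (Real.pi ^ d * (∏ i, (α i).factorial) * (L - ∑ i, α i).factorial /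
        (d + L).factorial) := by
  have hfac : (0 : ℝ) < (d + L).factorial := by positivity
  have h1 : ∀ z : Cd d, ENNReal.ofReal ((∏ i, ‖z i‖ ^ (2 * α i)) / (1 + ‖z‖ ^ 2) ^ (d + L + 1)) =
      ∫⁻ s in Ioi (0 : ℝ), ENNReal.ofReal (s ^ (d + L) * Real.exp (-s) / (d + L).factorial) *
        ∏ i, ENNReal.ofReal (‖z i‖ ^ (2 * α i) * Real.exp (-(s * ‖z i‖ ^ 2))) := fun z => by
    have h2 : (∏ i, ‖z i‖ ^ (2 * α i)) / (1 + ‖z‖ ^ 2) ^ (d + L + 1) =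
        (∏ i, ‖z i‖ ^ (2 * α i)) / (d + L).factorial *
          ((d + L).factorial / (1 + ‖z‖ ^ 2) ^ (d + L + 1)) := by
      field_simp
    rw [h2, ENNReal.ofReal_mul (by positivity), ← lintegral_pow_mul_exp _ (by positivity),
      ← lintegral_const_mul _ (by fun_prop)]
    refine setLIntegral_congr_fun measurableSet_Ioi fun s hs => ?_
    have hs' : (0 : ℝ) < s := hs
    simp only
    rw [← ENNReal.ofReal_prod_of_nonneg fun i _ => by positivity,
      ← ENNReal.ofReal_mul (by positivity), ← ENNReal.ofReal_mul (by positivity),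
      Finset.prod_mul_distrib, ← Real.exp_sum, Finset.sum_neg_distrib, ← Finset.mul_sum,
      ← EuclideanSpace.norm_sq_eq, add_mul, neg_add, Real.exp_add, one_mul, mul_comm s (‖z‖ ^ 2)]
    congr 1
    ring
  simp only [h1]
  rw [lintegral_lintegral_swap]
  · have h3 : ∀ s ∈ Ioi (0 : ℝ), ∫⁻ z : Cd d,
        ENNReal.ofReal (s ^ (d + L) * Real.exp (-s) / (d + L).factorial) *
          ∏ i, ENNReal.ofReal (‖z i‖ ^ (2 * α i) * Real.exp (-(s * ‖z i‖ ^ 2))) =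
        ENNReal.ofReal (Real.pi ^ d * (∏ i, (α i).factorial) / (d + L).factorial) *
          ENNReal.ofReal (s ^ (L - ∑ i, α i) * Real.exp (-(1 * s))) := fun s hs => by
      have hs' : (0 : ℝ) < s := hs
      rw [lintegral_const_mul _ (by fun_prop), lintegral_Cd_prod
        (f := fun i w => ENNReal.ofReal (‖w‖ ^ (2 * α i) * Real.exp (-(s * ‖w‖ ^ 2))))
        (fun i => by fun_prop)]
      simp only [lintegral_norm_pow_mul_exp _ hs']
      rw [← ENNReal.ofReal_prod_of_nonneg fun i _ => by positivity,
        ← ENNReal.ofReal_mul (by positivity), ← ENNReal.ofReal_mul (by positivity),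
        Finset.prod_div_distrib, Finset.prod_mul_distrib, Finset.prod_pow_eq_pow_sum,
        Finset.sum_add_distrib, Finset.prod_const, Finset.card_univ, Fintype.card_fin]
      -- The coordinate integrals consume ∑ (α_i + 1) powers of s, leaving L - ∑ α_i for the last
      -- Gamma integral.
      have h4 : s ^ (d + L) = s ^ (L - ∑ i, α i) * s ^ (∑ i, α i + ∑ _i : Fin d, 1) := by
        rw [← pow_add]
        congr 1
        simp
        omega
      rw [h4, one_mul]
      congr 1
      push_cast
      field_simp
    rw [setLIntegral_congr_fun measurableSet_Ioi h3, lintegral_const_mul _ (by fun_prop),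
      lintegral_pow_mul_exp _ one_pos, ← ENNReal.ofReal_mul (by positivity)]
    congr 1
    rw [one_pow, div_one]
    ring
  · fun_prop

end MonomialIntegrals

/-! ### Uniqueness of reproducing kernels and expansion in an orthonormal family -/

section ReproducingKernel

variable {Λ : Type*} [MeasurableSpace Λ] {μ : Measure Λ}

/-- Reproduce a section of each kernel by means of the other: the two integrals are conjugate.
Taking K' = K shows that K is Hermitian, which then gives uniqueness at every point. -/
theorem IsReproducingKernel.conj_apply {H : Submodule ℂ (Λ → ℂ)} {K K' : Λ → Λ → ℂ}
    (h : IsReproducingKernel μ H K) (h' : IsReproducingKernel μ H K') (x w : Λ) :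
    K' w x = conj (K x w) := by
  rw [h.reproducing _ (h'.mem x) w, h'.reproducing _ (h.mem w) x, ← integral_conj]
  refine integral_congr_ae (Eventually.of_forall fun z => ?_)
  simp [mul_comm]

theorem IsReproducingKernel.unique {H : Submodule ℂ (Λ → ℂ)} {K K' : Λ → Λ → ℂ}
    (h : IsReproducingKernel μ H K) (h' : IsReproducingKernel μ H K') : K = K' := by
  ext w x
  rw [h.conj_apply h, h.conj_apply h']

theorem IsOrthonormalFamily.isReproducingKernel {N : ℕ} {ψ : Fin N → Λ → ℂ}
    (h : IsOrthonormalFamily μ ψ) :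
    IsReproducingKernel μ (Submodule.span ℂ (range ψ)) (orthKernel ψ) := by
  refine ⟨fun f hf => ?_, fun w => ?_, fun f hf w => ?_⟩
  · obtain ⟨c, rfl⟩ := (Submodule.mem_span_range_iff_exists_fun ℂ).1 hf
    exact memLp_finsetSum' _ fun a _ => (h.memLp a).const_smul (c a)
  · refine (Submodule.mem_span_range_iff_exists_fun ℂ).2 ⟨fun a => conj (ψ a w), ?_⟩
    ext z
    simp [orthKernel, mul_comm]
  · obtain ⟨c, rfl⟩ := (Submodule.mem_span_range_iff_exists_fun ℂ).1 hf
    have h1 : ∀ z, (∑ a, c a • ψ a) z * conj (orthKernel ψ z w) =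
        ∑ a, ∑ b, c a * ψ b w * (ψ a z * conj (ψ b z)) := fun z => by
      simp only [orthKernel, Finset.sum_apply, Pi.smul_apply, smul_eq_mul, map_sum, map_mul,
        Complex.conj_conj]
      rw [Finset.sum_mul_sum]
      exact Finset.sum_congr rfl fun a _ => Finset.sum_congr rfl fun b _ => by ring
    simp only [h1]
    rw [integral_finsetSum _ fun a _ => integrable_finsetSum _ fun b _ =>
      (h.integrable_mul_conj a b).const_mul _, Finset.sum_apply]
    refine Finset.sum_congr rfl fun a _ => ?_
    rw [integral_finsetSum _ fun b _ => (h.integrable_mul_conj a b).const_mul _]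
    simp [integral_const_mul, h.integral]

end ReproducingKernel

/-! ### The orthonormal basis of weighted monomials -/

section Monomials

variable {d L : ℕ}

/-- The weight `(1 + ‖z‖²)^{(d + L + 1) / 2}`. -/
def polyWeight (d L : ℕ) (z : Cd d) : ℝ := (1 + ‖z‖ ^ 2) ^ (((d : ℝ) + L + 1) / 2)

theorem polyWeight_pos (z : Cd d) : 0 < polyWeight d L z := by
  unfold polyWeight
  positivity

theorem polyWeight_sq (z : Cd d) : polyWeight d L z ^ 2 = (1 + ‖z‖ ^ 2) ^ (d + L + 1) := by
  have h : ((d : ℝ) + L + 1) / 2 * (2 : ℕ) = (d + L + 1 : ℕ) := by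
    push_cast
    ring
  rw [polyWeight, ← Real.rpow_natCast, ← Real.rpow_mul (by positivity), h, Real.rpow_natCast]

theorem weightedMonomial_eq (α : Fin d → ℕ) (z : Cd d) :
    weightedMonomial d L α z = (∏ i, z i ^ α i) / (polyWeight d L z : ℂ) := rfl

theorem measurable_weightedMonomial (α : Fin d → ℕ) : Measurable (weightedMonomial d L α) := by
  have h1 : Measurable fun z : Cd d => ∏ i, z i ^ α i := by fun_prop
  have h2 : Measurable (polyWeight d L) := by
    unfold polyWeight
    fun_prop
  exact h1.div (Complex.measurable_ofReal.comp h2)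

theorem norm_weightedMonomial_sq (α : Fin d → ℕ) (z : Cd d) :
    ‖weightedMonomial d L α z‖ ^ 2 =
      (∏ i, ‖z i‖ ^ (2 * α i)) / (1 + ‖z‖ ^ 2) ^ (d + L + 1) := by
  rw [weightedMonomial_eq, norm_div, div_pow, Complex.norm_real,
    Real.norm_of_nonneg (polyWeight_pos z).le, polyWeight_sq, norm_prod, ← Finset.prod_pow]
  simp only [norm_pow, ← pow_mul, mul_comm]

theorem memLp_weightedMonomial {α : Fin d → ℕ} (hα : ∑ i, α i ≤ L) :
    MemLp (weightedMonomial d L α) 2 volume := by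
  have hm := (measurable_weightedMonomial (L := L) α).aestronglyMeasurable (μ := volume)
  rw [memLp_two_iff_integrable_sq_norm hm]
  refine ⟨(hm.norm.pow 2), ?_⟩
  rw [hasFiniteIntegral_iff_ofReal (Eventually.of_forall fun z => sq_nonneg _)]
  simp only [norm_weightedMonomial_sq]
  rw [lintegral_monomial hα]
  exact ENNReal.ofReal_lt_top

theorem integral_weightedMonomial_self {α : Fin d → ℕ} (hα : ∑ i, α i ≤ L) :
    ∫ z, weightedMonomial d L α z * conj (weightedMonomial d L α z) =
      ((Real.pi ^ d * (∏ i, (α i).factorial) * (L - ∑ i, α i).factorial /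
        (d + L).factorial : ℝ) : ℂ) := by
  have h1 : ∀ z, weightedMonomial d L α z * conj (weightedMonomial d L α z) =
      ((‖weightedMonomial d L α z‖ ^ 2 : ℝ) : ℂ) := fun z => by
    rw [Complex.mul_conj, Complex.normSq_eq_norm_sq]
  simp only [h1]
  rw [integral_complex_ofReal, integral_eq_lintegral_of_nonneg_ae
    (Eventually.of_forall fun z => sq_nonneg _)
    ((measurable_weightedMonomial α).norm.pow_const 2).aestronglyMeasurable]
  simp only [norm_weightedMonomial_sq]
  rw [lintegral_monomial hα, ENNReal.toReal_ofReal (by positivity)]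

theorem integral_weightedMonomial_of_ne {α β : Fin d → ℕ} (h : α ≠ β) :
    ∫ z, weightedMonomial d L α z * conj (weightedMonomial d L β z) = 0 := by
  obtain ⟨i, hi⟩ := Function.ne_iff.1 h
  -- Rotating coordinate i by this angle preserves volume and the weight, and multiplies the
  -- integrand by e^{iθ(α_i - β_i)} = -1, so the integral equals its own negative.
  set θ : ℝ := Real.pi / ((α i : ℝ) - β i)
  have hi' : (α i : ℝ) - β i ≠ 0 := sub_ne_zero.2 (by exact_mod_cast hi)
  set c : Circle := Circle.exp θ
  have hc : (c : ℂ) ^ α i * conj ((c : ℂ) ^ β i) = -1 := by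
    have h1 : (c : ℂ) = Complex.exp (θ * Complex.I) := Circle.coe_exp θ
    rw [h1, ← Complex.exp_nat_mul, ← Complex.exp_nat_mul, ← Complex.exp_conj, ← Complex.exp_add,
      ← Complex.exp_pi_mul_I]
    congr 1
    have h2 : (θ : ℂ) * ((α i : ℂ) - β i) = Real.pi := by
      have : θ * ((α i : ℝ) - β i) = Real.pi := div_mul_cancel₀ _ hi'
      exact_mod_cast congrArg (fun x : ℝ => (x : ℂ)) this
    simp only [map_mul, map_natCast, Complex.conj_ofReal, Complex.conj_I]
    linear_combination Complex.I * h2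
  let e : Fin d → (ℂ ≃ₗᵢ[ℝ] ℂ) := fun j => if j = i then rotation c else LinearIsometryEquiv.refl ℝ ℂ
  let U : Cd d ≃ₗᵢ[ℝ] Cd d := LinearIsometryEquiv.piLpCongrRight 2 e
  have hU : ∀ (z : Cd d) (j : Fin d), U z j = (if j = i then (c : ℂ) else 1) * z j := fun z j => by
    by_cases hj : j = i
    · simp [U, e, hj]
    · simp [U, e, hj]
  have hmon : ∀ (γ : Fin d → ℕ) (z : Cd d),
      weightedMonomial d L γ (U z) = (c : ℂ) ^ γ i * weightedMonomial d L γ z := fun γ z => by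
    have hw : polyWeight d L (U z) = polyWeight d L z := by
      rw [polyWeight, LinearIsometryEquiv.norm_map, polyWeight]
    have hp : ∏ j, (if j = i then (c : ℂ) else 1) ^ γ j = (c : ℂ) ^ γ i := by
      rw [Finset.prod_eq_single i (fun j _ hj => by rw [if_neg hj, one_pow]) (by simp), if_pos rfl]
    simp only [weightedMonomial_eq, hw, hU, mul_pow, Finset.prod_mul_distrib, hp, mul_div_assoc]
  have hinv := U.measurePreserving.integral_comp U.toMeasurableEquiv.measurableEmbedding
    fun z => weightedMonomial d L α z * conj (weightedMonomial d L β z)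
  have hneg : ∀ z, weightedMonomial d L α (U z) * conj (weightedMonomial d L β (U z)) =
      -(weightedMonomial d L α z * conj (weightedMonomial d L β z)) := fun z => by
    rw [hmon, hmon, map_mul]
    linear_combination (weightedMonomial d L α z * conj (weightedMonomial d L β z)) * hc
  simp only [hneg] at hinv
  rw [integral_neg] at hinv
  exact self_eq_neg.1 hinv.symm

/-- The homogeneous multi-indices of degree `L` in `d + 1` variables, which stand for the
multi-indices of degree at most `L` in `d` variables. -/
abbrev multiIndex (d L : ℕ) : Type := (Finset.univ : Finset (Fin (d + 1))).finsuppAntidiag L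

theorem card_multiIndex : Fintype.card (multiIndex d L) = (d + L).choose d := by
  rw [Fintype.card_coe, Finset.card_finsuppAntidiag_nat_eq_choose, Finset.card_univ,
    Fintype.card_fin, Nat.add_right_comm, Nat.add_sub_cancel, ← Nat.choose_symm_add]

/-- An enumeration of the multi-indices. -/
def multiIndexEquiv (d L : ℕ) : Fin ((d + L).choose d) ≃ multiIndex d L :=
  (Fintype.equivFinOfCardEq card_multiIndex).symm

theorem multiIndex.sum_eq (β : multiIndex d L) : β.1 0 + ∑ i : Fin d, β.1 i.succ = L := by
  have h := (Finset.mem_finsuppAntidiag.1 β.2).1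
  rwa [Fin.sum_univ_succ] at h

/-- The constant that normalizes a weighted monomial in `L²`. -/
def monomialConst (β : multiIndex d L) : ℝ :=
  √((d + L).factorial / (Real.pi ^ d * ∏ i, (β.1 i).factorial))

/-- The orthonormal family of weighted monomials. -/
def monomialFamily (d L : ℕ) (a : Fin ((d + L).choose d)) (z : Cd d) : ℂ :=
  monomialConst (multiIndexEquiv d L a) *
    weightedMonomial d L (fun i => (multiIndexEquiv d L a).1 i.succ) z

theorem monomialConst_sq (β : multiIndex d L) :
    monomialConst β ^ 2 = (d + L).factorial / (Real.pi ^ d * ∏ i, (β.1 i).factorial) :=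
  Real.sq_sqrt (by positivity)

theorem monomialConst_pos (β : multiIndex d L) : 0 < monomialConst β :=
  Real.sqrt_pos.2 (by positivity)

theorem isOrthonormalFamily_monomialFamily :
    IsOrthonormalFamily volume (monomialFamily d L) := by
  have hle : ∀ β : multiIndex d L, ∑ i : Fin d, β.1 i.succ ≤ L := fun β => by
    have := β.sum_eq
    omega
  refine ⟨fun a => (measurable_weightedMonomial _).const_mul _,
    fun a => (memLp_weightedMonomial (hle _)).const_mul _, fun a b => ?_⟩
  have h1 : ∀ z, monomialFamily d L a z * conj (monomialFamily d L b z) =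
      (monomialConst (multiIndexEquiv d L a) * monomialConst (multiIndexEquiv d L b) : ℂ) *
        (weightedMonomial d L (fun i => (multiIndexEquiv d L a).1 i.succ) z *
          conj (weightedMonomial d L (fun i => (multiIndexEquiv d L b).1 i.succ) z)) := fun z => by
    simp only [monomialFamily, map_mul, Complex.conj_ofReal]
    ring
  simp only [h1]
  rw [integral_const_mul]
  split_ifs with hab
  · subst hab
    set β := multiIndexEquiv d L a
    have h2 : L - ∑ i : Fin d, β.1 i.succ = β.1 0 := by
      have := β.sum_eq
      omega
    rw [integral_weightedMonomial_self (hle β), h2, ← Complex.ofReal_mul, ← Complex.ofReal_mul,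
      ← sq, monomialConst_sq, Fin.prod_univ_succ, ← Complex.ofReal_one]
    congr 1
    push_cast
    have h3 : (∏ i : Fin d, ((β.1 i.succ).factorial : ℝ)) ≠ 0 :=
      Finset.prod_ne_zero_iff.2 fun i _ => by positivity
    field_simp
  · rw [integral_weightedMonomial_of_ne, mul_zero]
    intro h
    refine hab ((multiIndexEquiv d L).injective (Subtype.ext (Finsupp.ext fun i => ?_)))
    have ha := (multiIndexEquiv d L a).sum_eq
    have hb := (multiIndexEquiv d L b).sum_eq
    have hsucc : ∀ i : Fin d, (multiIndexEquiv d L a).1 i.succ = (multiIndexEquiv d L b).1 i.succ :=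
      fun i => congrFun h i
    refine Fin.cases ?_ hsucc i
    simp only [hsucc] at ha
    omega

theorem span_monomialFamily :
    Submodule.span ℂ (range (monomialFamily d L)) = weightedPolynomials d L := by
  refine le_antisymm (Submodule.span_le.2 ?_) (Submodule.span_le.2 ?_)
  · rintro _ ⟨a, rfl⟩
    refine Submodule.smul_mem _ _ (Submodule.subset_span ⟨_, ?_, rfl⟩)
    have := (multiIndexEquiv d L a).sum_eq
    omega
  · rintro _ ⟨α, hα, rfl⟩
    -- The extra zeroth index takes up the missing degree.
    let β : multiIndex d L := ⟨Finsupp.equivFunOnFinite.symm (Fin.cons (L - ∑ i, α i) α), by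
      rw [Finset.mem_finsuppAntidiag]
      refine ⟨?_, Finset.subset_univ _⟩
      simp only [Finsupp.equivFunOnFinite_symm_apply_apply]
      rw [Fin.sum_univ_succ]
      simp only [Fin.cons_zero, Fin.cons_succ]
      omega⟩
    have hβ : weightedMonomial d L α =
        (monomialConst β : ℂ)⁻¹ • monomialFamily d L ((multiIndexEquiv d L).symm β) := by
      ext z
      have hc : (monomialConst β : ℂ) ≠ 0 := Complex.ofReal_ne_zero.2 (monomialConst_pos β).ne'
      simp only [monomialFamily, Pi.smul_apply, smul_eq_mul, Equiv.apply_symm_apply]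
      rw [inv_mul_cancel_left₀ hc]
      rfl
    rw [hβ]
    exact Submodule.smul_mem _ _ (Submodule.subset_span ⟨_, rfl⟩)

theorem isReproducingKernel_monomialFamily :
    IsReproducingKernel volume (weightedPolynomials d L) (orthKernel (monomialFamily d L)) := by
  rw [← span_monomialFamily]
  exact isOrthonormalFamily_monomialFamily.isReproducingKernel

end Monomials

/-! ### Closed form of the kernel -/

section Kernel

variable {d L : ℕ}

/-- The multinomial theorem for `1 + ⟨z, w⟩`. -/
theorem one_add_inner_pow (z w : Cd d) :
    (1 + inner ℂ w z) ^ L = ∑ β : multiIndex d L,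
      ((L.factorial / ∏ i, (β.1 i).factorial : ℝ) : ℂ) *
        ∏ i : Fin d, (z i * conj (w i)) ^ β.1 i.succ := by
  -- The summand 1 is the variable of index zero, so the terms of the multinomial expansion match
  -- the homogeneous multi-indices.
  have h1 : (1 : ℂ) + inner ℂ w z =
      ∑ i : Fin (d + 1), (Fin.cons 1 fun j => z j * conj (w j) : Fin (d + 1) → ℂ) i := by
    rw [Fin.sum_univ_succ]
    simp [PiLp.inner_apply]
  rw [h1, Finset.sum_pow_eq_sum_piAntidiag,
    Finset.sum_coe_sort (Finset.finsuppAntidiag Finset.univ L) fun β : Fin (d + 1) →₀ ℕ =>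
      ((L.factorial / ∏ i, (β i).factorial : ℝ) : ℂ) *
        ∏ i : Fin d, (z i * conj (w i)) ^ β i.succ]
  symm
  refine Finset.sum_nbij' (fun β => ⇑β) (fun k => Finsupp.equivFunOnFinite.symm k) ?_ ?_ ?_ ?_ ?_
  · intro β hβ
    rw [Finset.mem_finsuppAntidiag] at hβ
    simpa using hβ.1
  · intro k hk
    rw [Finset.mem_piAntidiag] at hk
    rw [Finset.mem_finsuppAntidiag]
    exact ⟨hk.1, Finset.subset_univ _⟩
  · intro β _
    ext i
    rfl
  · intro k _
    rfl
  · intro β hβ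
    have hsum := (Finset.mem_finsuppAntidiag.1 hβ).1
    have hspec := Nat.multinomial_spec Finset.univ (β : Fin (d + 1) → ℕ)
    rw [hsum] at hspec
    have h2 : (∏ i, ((β i).factorial : ℝ)) ≠ 0 :=
      Finset.prod_ne_zero_iff.2 fun i _ => by positivity
    have h3 : (L.factorial : ℝ) / (∏ i, (β i).factorial : ℕ) =
        (Nat.multinomial Finset.univ (β : Fin (d + 1) → ℕ) : ℝ) := by
      rw [← hspec]
      push_cast
      field_simp
    rw [h3, Fin.prod_univ_succ]
    simp

/-- The reproducing kernel of the weighted polynomials. -/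
theorem orthKernel_monomialFamily (z w : Cd d) :
    orthKernel (monomialFamily d L) z w =
      (((d + L).choose d : ℕ) : ℂ) * ((d.factorial : ℕ) : ℂ) * (1 + inner ℂ w z) ^ L /
        ((Real.pi : ℂ) ^ d * (polyWeight d L z * polyWeight d L w)) := by
  -- The normalization carries (d + L)!, while the multinomial coefficient accounts only for L!; the
  -- quotient is N d!.
  have hN : ((d + L).factorial : ℂ) = ((d + L).choose d : ℕ) * d.factorial * L.factorial := by
    have := Nat.add_choose_mul_factorial_mul_factorial d L
    rw [← Nat.choose_symm_add] at this
    exact_mod_cast this.symm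
  have hL : (L.factorial : ℂ) ≠ 0 := by exact_mod_cast L.factorial_ne_zero
  have hpi : (Real.pi : ℂ) ≠ 0 := Complex.ofReal_ne_zero.2 Real.pi_ne_zero
  have hz : (polyWeight d L z : ℂ) ≠ 0 := Complex.ofReal_ne_zero.2 (polyWeight_pos z).ne'
  have hw : (polyWeight d L w : ℂ) ≠ 0 := Complex.ofReal_ne_zero.2 (polyWeight_pos w).ne'
  unfold orthKernel monomialFamily
  rw [(multiIndexEquiv d L).sum_comp fun β => ((monomialConst β : ℂ) *
    weightedMonomial d L (fun i => β.1 i.succ) z) * conj ((monomialConst β : ℂ) *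
      weightedMonomial d L (fun i => β.1 i.succ) w), one_add_inner_pow, Finset.mul_sum,
    Finset.sum_div]
  refine Finset.sum_congr rfl fun β _ => ?_
  have hc : (monomialConst β : ℂ) * monomialConst β =
      (((d + L).factorial / (Real.pi ^ d * ∏ i, (β.1 i).factorial) : ℝ) : ℂ) := by
    rw [← monomialConst_sq, ← Complex.ofReal_mul, sq]
  have hfac : (∏ i, ((β.1 i).factorial : ℂ)) ≠ 0 :=
    Finset.prod_ne_zero_iff.2 fun i _ => by exact_mod_cast (β.1 i).factorial_ne_zero
  simp only [weightedMonomial_eq, map_mul, map_div₀, map_prod, map_pow, Complex.conj_ofReal,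
    mul_pow, Finset.prod_mul_distrib]
  set Z := ∏ i : Fin d, z i ^ β.1 i.succ
  set W := ∏ i : Fin d, conj (w i) ^ β.1 i.succ
  calc _ = ((monomialConst β : ℂ) * monomialConst β) * (Z * W) /
        (polyWeight d L z * polyWeight d L w) := by ring
    _ = _ := by
      rw [hc]
      push_cast
      rw [hN]
      field_simp

theorem sphereKernel_eq (g : ℝ → ℝ) : sphereKernel d L g = fun p q =>
    (jacobianRoot d L g ‖radialMapInv g (stereo p)‖ : ℂ) *
      ((jacobianRoot d L g ‖radialMapInv g (stereo q)‖ : ℂ) *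
        orthKernel (monomialFamily d L) (radialMapInv g (stereo p))
          (radialMapInv g (stereo q))) := by
  ext p q
  have hj : ∀ z : Cd d, jacobianRoot d L g ‖z‖ =
      radialWeight d L g ‖z‖ * polyWeight d L z / 2 ^ d := fun z => rfl
  have hpi : (Real.pi : ℂ) ≠ 0 := Complex.ofReal_ne_zero.2 Real.pi_ne_zero
  have hA : ∀ z : Cd d, (polyWeight d L z : ℂ) ≠ 0 := fun z =>
    Complex.ofReal_ne_zero.2 (polyWeight_pos z).ne'
  have hz := hA (radialMapInv g (stereo p))
  have hw := hA (radialMapInv g (stereo q))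
  simp only [sphereKernel, orthKernel_monomialFamily, hj]
  push_cast
  rw [mul_comm 2 d, pow_mul, sq]
  field_simp

end Kernel

/-! ### Almost sure finiteness and conclusion -/

/-- A determinantal point process of a finite-dimensional projection is almost surely finite. -/
theorem IsDPP.ae_univ_ne_top {Ω Λ : Type*} [MeasurableSpace Ω] [TopologicalSpace Λ]
    [MeasurableSpace Λ] {P : Measure Ω} {X : Ω → Measure Λ} {μ : Measure Λ} [SigmaFinite μ]
    {N : ℕ} {ψ : Fin N → Λ → ℂ} (hψ : IsOrthonormalFamily μ ψ)
    (hX : IsDPP P X μ (orthKernel ψ)) : ∀ᵐ ω ∂P, X ω univ ≠ ∞ := by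
  obtain ⟨⟨hXm, -⟩, ρ, ⟨-, hρ, -⟩, hdet⟩ := hX
  have hρ' : ρ 1 = detIntensity (orthKernel ψ) 1 := by
    ext x
    have h := (hdet 1 x).symm.trans (coe_detIntensity_orthKernel 1 x).symm
    exact_mod_cast h
  have h1 := hρ 1 (fun _ => univ) (fun _ => .univ)
    fun i j hij => (hij (Subsingleton.elim i j)).elim
  simp only [Finset.univ_unique, Finset.prod_singleton, Set.pi_univ, hρ'] at h1
  -- The expected number of points is the integral of K(x, x), which is N; finite expectation gives
  -- almost sure finiteness.
  have h2 := congrArg (fun ν => ν univ) (hψ.map_tail_detMeasure 0)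
  simp only [Measure.smul_apply, detMeasure_zero_univ] at h2
  rw [Measure.map_apply (measurable_pi_lambda _ fun i => measurable_pi_apply _) .univ,
    preimage_univ, detMeasure, withDensity_apply _ .univ] at h2
  have hm : Measurable fun ω => X ω univ := (Measure.measurable_coe .univ).comp hXm
  refine (ae_lt_top hm ?_).mono fun ω hω => hω.ne
  rw [h1, h2]
  simp

theorem mainTheorem6 (d L : ℕ) (hd : 1 ≤ d) (g : ℝ → ℝ) (hg : IsAdmissible g)
    (hg' : ∀ᵐ t ∂(volume.restrict (Ioi (0 : ℝ))), deriv g t ≠ 0) :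
    (∃ (Ω : Type) (_ : MeasurableSpace Ω) (P : Measure Ω) (_ : IsProbabilityMeasure P)
      (X : Ω → Measure (Cd d)),
      IsProjectionDPP P X volume (weightedPolynomials d L) ∧
        ∀ᵐ ω ∂P, X ω univ = (((d + L).choose d : ℕ) : ℝ≥0∞)) ∧
    (∀ (Ω : Type u) (_ : MeasurableSpace Ω) (P : Measure Ω) (_ : IsProbabilityMeasure P)
      (X : Ω → Measure (Cd d)),
      IsProjectionDPP P X volume (weightedPolynomials d L) →
        Measurable (toSph g : Cd d → Sph d) ∧
        IsDPP P (fun ω => (X ω).map (toSph g)) (surfaceMeasure d) (sphereKernel d L g)) := by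
  have hψ : IsOrthonormalFamily volume (monomialFamily d L) := isOrthonormalFamily_monomialFamily
  refine ⟨?_, ?_⟩
  · obtain ⟨Ω, mΩ, P, hP, X, hX, hN⟩ := hψ.exists_isDPP
    exact ⟨Ω, mΩ, P, hP, X, ⟨_, isReproducingKernel_monomialFamily, hX⟩, hN⟩
  · rintro Ω mΩ P hP X ⟨K, hK, hX⟩
    -- The kernels agree at every point, not just almost everywhere, so the process is determinantal
    -- for the explicit kernel.
    obtain rfl := hK.unique isReproducingKernel_monomialFamily
    refine ⟨hg.measurable_toSph, ?_⟩
    rw [sphereKernel_eq]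
    exact hX.map (hX.ae_univ_ne_top hψ) hg.measurable_toSph
      (hg.measurable_radialMapInv.comp measurable_stereo) hg.leftInverse_toSph
      (hg.measurable_jacobianRoot_sphere hd) (hg.map_toSph hg' hd)

end
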